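/- Let $M$ be a finite-dimensional smooth manifold (Hausdorff, without boundary), let $\nabla$ be a smooth symmetric (torsion-free) linear connection on $M$, and let $\hbar\neq 0$ be a real number. Let $C^\infty(M)$ be the algebra of complex-valued smooth functions on $M$ and, for $x\in M$, let $\mathfrak m_x\subset C^\infty(M)$ be the ideal of functions vanishing at $x$. A differential operator of order (at most) $r$ is a $\mathbb C$-linear map $P\colon C^\infty(M)\to C^\infty(M)$ with $P(\mathfrak m_x^{r+1})\subseteq\mathfrak m_x$ for every $x\in M$; a linear differential operator is one of some order $r\in\mathbb N$. All tensor fields below are smooth with complex values. The symbol of order $r$ of an operator $P$ of order $r$ is the symmetric contravariant tensor field $\sigma^r(P)$ of order $r$ such that $(Pf)(x)=\langle\sigma^r(P)_x,d^r_xf\rangle$ for all $x\in M$ and $f\in\mathfrak m_x^r$, where $\langle\ ,\ \rangle$ is tensor contraction and $d_x^rf$ is the $r$-th differential of $f$ at $x$, computed in any local coordinates around $x$; such a tensor field exists and is unique. For a symmetric contravariant tensor field $\Phi$ of order $r$ and $f\in C^\infty(M)$ put $$\widehat\Phi(f):=(-i\hbar)^r\langle\Phi,\nabla^r_{\mathrm{sym}}f\rangle,$$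 where $\nabla^r_{\mathrm{sym}}f$ is the symmetrization $\frac1{r!}\sum_\pi$ of the $r$-th iterated covariant differential of $f$. For a not necessarily homogeneous symmetric contravariant tensor field, that is, a finite sum $\Phi=\sum_j\Phi_j$ with $\Phi_j$ homogeneous of order $j$, put $\widehat\Phi:=\sum_j\widehat\Phi_j$. Then $\Phi\mapsto\widehat\Phi$ is a ($\mathbb C$-linear) bijection from the not necessarily homogeneous symmetric contravariant tensor fields on $M$ onto the linear differential operators on $C^\infty(M)$. If $P$ is an operator of order $r$ and $\Phi$ is the tensor field with $\widehat\Phi=P$, then $\Phi=\Phi_r+\Phi_{r-1}+\dots+\Phi_0$ (so $\Phi_j=0$ for $j>r$), $$\sigma^r(P)=(-i\hbar)^r\Phi_r,$$ for $k=1,\dots,r$ the operator $P-\widehat\Phi_r-\dots-\widehat\Phi_{r-k+1}$ is of order $r-k$ and $$\sigma^{r-k}\bigl(P-\widehat\Phi_r-\dots-\widehat\Phi_{r-k+1}\bigr)=(-i\hbar)^{r-k}\Phi_{r-k},$$ and $$P=\widehat\Phi=\widehat\Phi_r+\widehat\Phi_{r-1}+\dots+\widehat\Phi_0 .$$ -/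

import Mathlib

open scoped Manifold ContDiff DirectSum

noncomputable section

namespace Quantization

variable {E : Type*} [NormedAddCommGroup E] [NormedSpace ℝ E]
  {M : Type*} [TopologicalSpace M] [ChartedSpace E M]

/-! ### Smooth functions and differential operators -/

variable (E M) in
/-- The `ℂ`-algebra `C^∞(M)` of complex valued smooth functions on `M`. -/
def SmoothFun : Subalgebra ℂ (M → ℂ) where
  carrier := {f | ContMDiff 𝓘(ℝ, E) 𝓘(ℝ, ℂ) ∞ f}
  mul_mem' hf hg := contDiff_mul.contMDiff.comp (hf.prodMk_space hg)
  add_mem' hf hg := hf.add hg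
  algebraMap_mem' _ := contMDiff_const

variable (E) in
/-- The ideal `𝔪_x` of the smooth functions that vanish at `x`. -/
def idealAt (x : M) : Ideal (SmoothFun E M) :=
  RingHom.ker ((Pi.evalRingHom (fun _ : M ↦ ℂ) x).comp (SmoothFun E M).val.toRingHom)

/-- `P` is a differential operator of order (at most) `r`: it maps `𝔪_x ^ (r + 1)` into `𝔪_x`
for each point `x`. -/
def HasOrder (r : ℕ) (P : SmoothFun E M →ₗ[ℂ] SmoothFun E M) : Prop :=
  ∀ x : M, ∀ f ∈ idealAt E x ^ (r + 1), P f ∈ idealAt E x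

theorem HasOrder.mono {r s : ℕ} (h : r ≤ s) {P : SmoothFun E M →ₗ[ℂ] SmoothFun E M}
    (hP : HasOrder r P) : HasOrder s P :=
  fun x f hf ↦ hP x f (Ideal.pow_le_pow_right (Nat.succ_le_succ h) hf)

variable (E M) in
/-- The linear differential operators on `C^∞(M)`, of any finite order. -/
def DiffOp : Submodule ℂ (SmoothFun E M →ₗ[ℂ] SmoothFun E M) where
  carrier := {P | ∃ r, HasOrder r P}
  zero_mem' := ⟨0, fun x _ _ ↦ (idealAt E x).zero_mem⟩
  add_mem' := by
    rintro P Q ⟨r, hP⟩ ⟨s, hQ⟩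
    exact ⟨max r s, fun x f hf ↦ (idealAt E x).add_mem
      (hP.mono (le_max_left r s) x f hf) (hQ.mono (le_max_right r s) x f hf)⟩
  smul_mem' := by
    rintro c P ⟨r, hP⟩
    refine ⟨r, fun x f hf ↦ ?_⟩
    rw [LinearMap.smul_apply, Algebra.smul_def]
    exact (idealAt E x).mul_mem_left _ (hP x f hf)

/-! ### Symmetric contravariant tensor fields -/

variable (E) in
/-- Complex contravariant tensors of order `r` at `x`: the `ℝ`-multilinear maps
`T_x^*M × ⋯ × T_x^*M → ℂ`. -/
abbrev ContraTensor (r : ℕ) (x : M) : Type _ :=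
  MultilinearMap ℝ (fun _ : Fin r ↦ Module.Dual ℝ (TangentSpace 𝓘(ℝ, E) x)) ℂ

variable (E M) in
/-- The smooth symmetric contravariant tensor fields of order `r` on `M` with complex values. The
components in a chart `e` are the values on the covectors `ℓ ∘ d_x e`, with `ℓ` in the dual of
the model space; they have to be smooth on the domain of `e`, for every chart `e`. -/
def SymTensorField (r : ℕ) : Submodule ℂ ((x : M) → ContraTensor E r x) where
  carrier := {Φ |
    (∀ (x : M) (π : Equiv.Perm (Fin r)) (ξ : Fin r → Module.Dual ℝ (TangentSpace 𝓘(ℝ, E) x)),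
      Φ x (fun k ↦ ξ (π k)) = Φ x ξ) ∧
    ∀ e ∈ IsManifold.maximalAtlas 𝓘(ℝ, E) ∞ M, ∀ ℓ : Fin r → Module.Dual ℝ E,
      ContMDiffOn 𝓘(ℝ, E) 𝓘(ℝ, ℂ) ∞
        (fun x ↦ Φ x fun k ↦ (ℓ k).comp (mvfderiv 𝓘(ℝ, E) e x).toLinearMap) e.source}
  zero_mem' := ⟨fun _ _ _ ↦ rfl, fun _ _ _ ↦ contMDiffOn_const⟩
  add_mem' := by
    rintro Φ Ψ ⟨hΦ, hΦ'⟩ ⟨hΨ, hΨ'⟩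
    refine ⟨fun x π ξ ↦ ?_, fun e he ℓ ↦ (hΦ' e he ℓ).add (hΨ' e he ℓ)⟩
    simp only [Pi.add_apply, _root_.add_apply, hΦ x π ξ, hΨ x π ξ]
  smul_mem' := by
    rintro c Φ ⟨hΦ, hΦ'⟩
    refine ⟨fun x π ξ ↦ ?_, fun e he ℓ ↦ (contDiff_const_smul c).contMDiff.comp_contMDiffOn (hΦ' e he ℓ)⟩
    simp only [Pi.smul_apply, _root_.smul_apply, hΦ x π ξ]

variable (E M) in
/-- The not necessarily homogeneous symmetric contravariant tensor fields: finite sums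
`Φ_r + ⋯ + Φ_0`, with `Φ_j` homogeneous of order `j`. -/
abbrev SymTensors : Type _ := ⨁ r : ℕ, SymTensorField E M r

/-- Covariant objects of order `r` at `x`, as functions of `r` tangent vectors. -/
abbrev CoTensor (E : Type*) [NormedAddCommGroup E] [NormedSpace ℝ E]
    {M : Type*} [TopologicalSpace M] [ChartedSpace E M] (r : ℕ) (x : M) : Type _ :=
  (Fin r → TangentSpace 𝓘(ℝ, E) x) → ℂ

/-- The contraction `⟨Φ, η⟩ = ∑ Φ^{i_1 ⋯ i_r} η_{i_1 ⋯ i_r}`, computed in a basis of the tangent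
space and its dual basis (for multilinear `η` it does not depend on the basis). -/
def contract [FiniteDimensional ℝ E] {r : ℕ} {x : M}
    (Φ : ContraTensor E r x) (η : CoTensor E r x) : ℂ :=
  let b : Module.Basis (Fin (Module.finrank ℝ E)) ℝ (TangentSpace 𝓘(ℝ, E) x) :=
    Module.finBasis ℝ E
  ∑ i : Fin r → Fin (Module.finrank ℝ E), Φ (fun k ↦ b.coord (i k)) * η (fun k ↦ b (i k))

/-! ### Symbols -/

/-- The `r`-th differential at `x` of the function `f`, computed in the chart `e`. -/
def chartDiff (e : OpenPartialHomeomorph M E) (r : ℕ) (f : M → ℂ) (x : M) : CoTensor E r x :=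
  fun v ↦ iteratedFDeriv ℝ r (f ∘ e.symm) (e x) fun k ↦ mvfderiv 𝓘(ℝ, E) e x (v k)

/-- `σ` is the symbol of order `r` of the operator `P` of order `r`:
`(P f)(x) = ⟨σ_x, d_x^r f⟩` for all points `x` and all `f ∈ 𝔪_x ^ r`, where `d_x^r f` is computed
in any local coordinates. -/
def IsSymbol [FiniteDimensional ℝ E] (r : ℕ) (P : SmoothFun E M →ₗ[ℂ] SmoothFun E M)
    (σ : SymTensorField E M r) : Prop :=
  HasOrder r P ∧
    ∀ (x : M), ∀ f ∈ idealAt E x ^ r, ∀ e ∈ IsManifold.maximalAtlas 𝓘(ℝ, E) ∞ M, x ∈ e.source →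
      (P f : M → ℂ) x = contract ((σ : (x : M) → ContraTensor E r x) x) (chartDiff e r f x)

/-! ### Iterated covariant differentials and quantization -/

variable [IsManifold 𝓘(ℝ, E) ∞ M]

/-- The covariant differential of a covariant tensor field `T`:
`(∇T)(v_0, v_1, …, v_r) = v_0 (T(X_1, …, X_r)) - ∑_i T(v_1, …, ∇_{v_0} X_i, …, v_r)`,
where `X_i` is a vector field that extends `v_i` and is smooth near the point. -/
def covDiff (nabla : CovariantDerivative 𝓘(ℝ, E) E (TangentSpace 𝓘(ℝ, E) : M → Type _)) {r : ℕ}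
    (T : (x : M) → CoTensor E r x) (x : M) : CoTensor E (r + 1) x :=
  fun v ↦
    mvfderiv 𝓘(ℝ, E) (fun y ↦ T y fun k ↦ FiberBundle.extend E (v k.succ) y) x (v 0) -
      ∑ k : Fin r, T x (Function.update (fun j ↦ v j.succ) k
        (nabla (FiberBundle.extend E (v k.succ)) x (v 0)))

/-- The iterated covariant differential `∇^r f`. -/
def iterCovDiff (nabla : CovariantDerivative 𝓘(ℝ, E) E (TangentSpace 𝓘(ℝ, E) : M → Type _))
    (f : M → ℂ) : (r : ℕ) → (x : M) → CoTensor E r x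
  | 0 => fun x _ ↦ f x
  | r + 1 => covDiff nabla (iterCovDiff nabla f r)

/-- The symmetrization `η_sym(v_1, …, v_r) = (1 / r!) ∑_π η(v_{π 1}, …, v_{π r})`. -/
def symmetrize {r : ℕ} {x : M} (η : CoTensor E r x) : CoTensor E r x :=
  fun v ↦ (r.factorial : ℂ)⁻¹ * ∑ π : Equiv.Perm (Fin r), η fun k ↦ v (π k)

/-- The quantized of a homogeneous tensor field `Φ` of order `r`, applied to the function `f`:
`(-iħ)^r ⟨Φ, ∇^r_sym f⟩`. -/
def quantized [FiniteDimensional ℝ E]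
    (nabla : CovariantDerivative 𝓘(ℝ, E) E (TangentSpace 𝓘(ℝ, E) : M → Type _)) (hbar : ℝ) {r : ℕ}
    (Φ : SymTensorField E M r) (f : SmoothFun E M) : M → ℂ :=
  fun x ↦ (-Complex.I * hbar) ^ r *
    contract ((Φ : (x : M) → ContraTensor E r x) x) (symmetrize (iterCovDiff nabla f r x))

end Quantization

end

/-!
An operator `P` of order `r` kills, at `x`, everything in `𝔪_x ^ (r + 1)`. By Hadamard's lemma a
smooth function belongs to `𝔪_x ^ 2` as soon as it vanishes at `x` together with its differential,
so on a product of `r` functions of `𝔪_x` the value of `P` at `x` depends only on their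
differentials, multilinearly and symmetrically. Polarization over such products gives existence and
uniqueness of the symbol.

In a chart the connection is the flat one plus Christoffel symbols, and these enter `∇ ^ r f` only
through derivatives of `f` of order less than `r`. Hence for `f ∈ 𝔪_x ^ r` the value of `∇ ^ r f`
at `x` is the ordinary `r`-th differential, and the operator quantizing a tensor field `Φ` of order
`r` has the symbol `(-iħ) ^ r Φ`. Quantization is therefore triangular with respect to the order:
subtracting from `P` the quantization of its rescaled symbol lowers the order, and this stops
after finitely many steps, whereas the top component of a nonzero `Φ` is seen in the symbol of its
quantization.
-/

noncomputable section

namespace Quantization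

/-! ### Products in a filtered ring -/

section Products

theorem prod_sub_prod_mem_of_sub_mem {A ι σ : Type*} [CommRing A] [SetLike σ A]
    [AddSubgroupClass σ A] (J : ℕ → σ) [SetLike.GradedMonoid J] (s : Finset ι) {f g : ι → A}
    (hf : ∀ k ∈ s, f k ∈ J 1) (hg : ∀ k ∈ s, g k ∈ J 1) (hfg : ∀ k ∈ s, f k - g k ∈ J 2) :
    ∏ k ∈ s, f k - ∏ k ∈ s, g k ∈ J (s.card + 1) := by
  classical
  induction s using Finset.induction_on with
  | empty => simpa only [Finset.prod_empty, sub_self] using zero_mem _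
  | insert a s ha ih =>
    simp only [Finset.forall_mem_insert] at hf hg hfg
    have split : f a * ∏ k ∈ s, f k - g a * ∏ k ∈ s, g k =
        f a * (∏ k ∈ s, f k - ∏ k ∈ s, g k) + (f a - g a) * ∏ k ∈ s, g k := by ring
    have hprod : ∏ k ∈ s, g k ∈ J s.card := by
      simpa only [Finset.sum_const, smul_eq_mul, mul_one] using
        SetLike.prod_mem_graded (A := J) (fun _ ↦ 1) g hg.2
    rw [Finset.prod_insert ha, Finset.prod_insert ha, Finset.card_insert_of_notMem ha, split]
    refine add_mem ?_ ?_
    · simpa only [add_comm] using SetLike.mul_mem_graded hf.1 (ih hf.2 hg.2 hfg.2)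
    · simpa only [add_comm, add_assoc, add_left_comm] using SetLike.mul_mem_graded hfg.1 hprod

theorem ideal_pow_induction {A : Type*} [CommRing A] (I : Ideal A) (n : ℕ) {C : A → Prop}
    (add : ∀ f g, C f → C g → C (f + g))
    (prod : ∀ (a : A) (f : Fin n → A), (∀ k, f k ∈ I) → C (a * ∏ k, f k)) :
    ∀ f ∈ I ^ n, C f := by
  induction n generalizing C with
  | zero => exact fun f _ ↦ by simpa using prod f Fin.elim0 (·.elim0)
  | succ n ih =>
    intro f hf
    rw [pow_succ'] at hf
    refine Submodule.mul_induction_on hf (fun m hm ↦ ?_) add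
    refine ih (C := fun g ↦ C (m * g)) (fun g h hg hh ↦ mul_add m g h ▸ add _ _ hg hh)
      fun a g hg ↦ ?_
    simpa [Fin.prod_univ_succ, mul_left_comm] using prod a (Fin.cons m g) (Fin.cases hm hg)

end Products

/-! ### Vanishing to finite order -/

section Vanishing

variable {𝕜 E F G H : Type*} [NontriviallyNormedField 𝕜] [NormedAddCommGroup E] [NormedSpace 𝕜 E]
  [NormedAddCommGroup F] [NormedSpace 𝕜 F] [NormedAddCommGroup G] [NormedSpace 𝕜 G]
  [NormedAddCommGroup H] [NormedSpace 𝕜 H]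

variable (𝕜) in
/-- `f` is smooth at `p` and its derivatives of order less than `k` vanish there. -/
def VanishesToOrder (k : ℕ) (f : E → G) (p : E) : Prop :=
  ContDiffAt 𝕜 ∞ f p ∧ ∀ j < k, iteratedFDeriv 𝕜 j f p = 0

namespace VanishesToOrder

variable {k l : ℕ} {f g : E → G} {p : E}

theorem mono (h : l ≤ k) (hf : VanishesToOrder 𝕜 k f p) : VanishesToOrder 𝕜 l f p :=
  ⟨hf.1, fun j hj ↦ hf.2 j (hj.trans_le h)⟩

theorem congr (hf : VanishesToOrder 𝕜 k f p) (hfg : f =ᶠ[nhds p] g) : VanishesToOrder 𝕜 k g p :=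
  ⟨hf.1.congr_of_eventuallyEq hfg.symm, fun j hj ↦ by
    rw [← (hfg.iteratedFDeriv (𝕜 := 𝕜) j).eq_of_nhds, hf.2 j hj]⟩

theorem of_contDiffAt (hf : ContDiffAt 𝕜 ∞ f p) : VanishesToOrder 𝕜 0 f p :=
  ⟨hf, fun _ hj ↦ absurd hj (Nat.not_lt_zero _)⟩

theorem of_eq_zero (hf : ContDiffAt 𝕜 ∞ f p) (h : f p = 0) : VanishesToOrder 𝕜 1 f p :=
  ⟨hf, fun j hj ↦ by
    obtain rfl : j = 0 := by lia
    rw [← norm_eq_zero, norm_iteratedFDeriv_zero, h, norm_zero]⟩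

theorem of_fderiv_eq_zero (hf : ContDiffAt 𝕜 ∞ f p) (h : f p = 0) (h' : fderiv 𝕜 f p = 0) :
    VanishesToOrder 𝕜 2 f p :=
  ⟨hf, fun j hj ↦ by
    obtain rfl | rfl : j = 0 ∨ j = 1 := by lia
    · rw [← norm_eq_zero, norm_iteratedFDeriv_zero, h, norm_zero]
    · rw [← norm_eq_zero, norm_iteratedFDeriv_one, h', norm_zero]⟩

theorem eq_zero (hf : VanishesToOrder 𝕜 (k + 1) f p) : f p = 0 := by
  rw [← norm_eq_zero, ← norm_iteratedFDeriv_zero (𝕜 := 𝕜), hf.2 0 k.succ_pos, norm_zero]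

theorem zero : VanishesToOrder 𝕜 k (0 : E → G) p :=
  ⟨contDiffAt_const, fun j _ ↦ by rw [iteratedFDeriv_zero]; rfl⟩

theorem add (hf : VanishesToOrder 𝕜 k f p) (hg : VanishesToOrder 𝕜 k g p) :
    VanishesToOrder 𝕜 k (f + g) p :=
  ⟨hf.1.add hg.1, fun j hj ↦ by
    rw [iteratedFDeriv_add_apply (hf.1.of_le (mod_cast le_top)) (hg.1.of_le (mod_cast le_top)),
      hf.2 j hj, hg.2 j hj, add_zero]⟩

theorem neg (hf : VanishesToOrder 𝕜 k f p) : VanishesToOrder 𝕜 k (-f) p :=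
  ⟨hf.1.neg, fun j hj ↦ by rw [iteratedFDeriv_neg_apply, hf.2 j hj, neg_zero]⟩

theorem sub (hf : VanishesToOrder 𝕜 k f p) (hg : VanishesToOrder 𝕜 k g p) :
    VanishesToOrder 𝕜 k (f - g) p :=
  sub_eq_add_neg f g ▸ hf.add hg.neg

theorem bilinear (B : F →L[𝕜] G →L[𝕜] H) {f : E → F} (hf : VanishesToOrder 𝕜 k f p)
    (hg : VanishesToOrder 𝕜 l g p) : VanishesToOrder 𝕜 (k + l) (fun z ↦ B (f z) (g z)) p := by
  refine ⟨(B.contDiff.contDiffAt.comp p hf.1).clm_apply hg.1, fun n hn ↦ ?_⟩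
  have hn' : (n : WithTop ℕ∞) ≤ ∞ := mod_cast le_top
  obtain ⟨u, hu, hfu⟩ := (hf.1.of_le hn').contDiffOn le_rfl (by simp)
  obtain ⟨v, hv, hgv⟩ := (hg.1.of_le hn').contDiffOn le_rfl (by simp)
  obtain ⟨w, hw, hwo, hpw⟩ := mem_nhds_iff.1 (Filter.inter_mem
    (by simpa using hu : u ∈ nhds p) (by simpa using hv : v ∈ nhds p))
  have leibniz := B.norm_iteratedFDerivWithin_le_of_bilinear (hfu.mono fun z hz ↦ (hw hz).1)
    (hgv.mono fun z hz ↦ (hw hz).2) hwo.uniqueDiffOn hpw le_rfl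
  simp only [iteratedFDerivWithin_of_isOpen _ hwo hpw] at leibniz
  refine norm_le_zero_iff.1 (leibniz.trans_eq ?_)
  rw [Finset.sum_eq_zero, mul_zero]
  intro i hi
  rcases lt_or_ge i k with hik | hki
  · rw [hf.2 i hik, norm_zero, mul_zero, zero_mul]
  · rw [hg.2 (n - i) (by have := Finset.mem_range.1 hi; lia), norm_zero, mul_zero]

theorem flip_comp {D V : Type*} [NormedAddCommGroup D] [NormedSpace 𝕜 D] [NormedAddCommGroup V]
    [NormedSpace 𝕜 V] {f : E → G} {Γ : E → D →L[𝕜] V} (B : V →L[𝕜] G →L[𝕜] H)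
    (hf : VanishesToOrder 𝕜 k f p) (hΓ : VanishesToOrder 𝕜 l Γ p) :
    VanishesToOrder 𝕜 (k + l) (fun z ↦ B.flip (f z) ∘L Γ z) p :=
  hf.bilinear (ContinuousLinearMap.compL 𝕜 D V H ∘L B.flip) hΓ

theorem clm_comp (A : G →L[𝕜] H) (hf : VanishesToOrder 𝕜 k f p) :
    VanishesToOrder 𝕜 k (A ∘ f) p :=
  ⟨A.contDiff.contDiffAt.comp p hf.1, fun j hj ↦ by
    rw [A.iteratedFDeriv_comp_left hf.1 (mod_cast le_top), hf.2 j hj]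
    exact map_zero (A.compContinuousMultilinearMapL 𝕜 _ _ _)⟩

theorem fderiv (hf : VanishesToOrder 𝕜 (k + 1) f p) : VanishesToOrder 𝕜 k (fderiv 𝕜 f) p :=
  ⟨hf.1.fderiv_right (by simp), fun j hj ↦ by
    rw [← norm_eq_zero, norm_iteratedFDeriv_fderiv, hf.2 (j + 1) (by lia), norm_zero]⟩

end VanishesToOrder

variable {𝔸 : Type*} [NormedCommRing 𝔸] [NormedAlgebra 𝕜 𝔸] {p : E}

variable (𝕜 𝔸) in
/-- The functions that vanish at `p` to order `k`. As `k` varies they filter the ring `E → 𝔸`. -/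
def vanishingSubgroup (p : E) (k : ℕ) : AddSubgroup (E → 𝔸) where
  carrier := {f | VanishesToOrder 𝕜 k f p}
  zero_mem' := .zero
  add_mem' := .add
  neg_mem' := .neg

instance : SetLike.GradedMonoid (vanishingSubgroup 𝕜 𝔸 p) where
  one_mem := .of_contDiffAt contDiffAt_const
  mul_mem _ _ _ _ hf hg := hf.bilinear (ContinuousLinearMap.mul 𝕜 𝔸) hg

theorem vanishesToOrder_sub_fderiv {f : E → G} (hf : ContDiffAt 𝕜 ∞ f p) (hfp : f p = 0) :
    VanishesToOrder 𝕜 2 (fun z ↦ f z - fderiv 𝕜 f p (z - p)) p := by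
  have hL : HasFDerivAt (fun z ↦ fderiv 𝕜 f p (z - p)) (fderiv 𝕜 f p) p :=
    (fderiv 𝕜 f p).hasFDerivAt.comp p ((hasFDerivAt_id p).sub_const p)
  refine .of_fderiv_eq_zero (hf.sub (by fun_prop)) (by simp [hfp]) ?_
  rw [fderiv_fun_sub (hf.differentiableAt (by simp)) hL.differentiableAt, hL.fderiv, sub_self]

theorem iteratedFDeriv_prod_clm {r : ℕ} (L : Fin r → E →L[𝕜] 𝔸) (p : E) (v : Fin r → E) :
    iteratedFDeriv 𝕜 r (∏ k, fun z ↦ L k (z - p)) p v =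
      ∑ π : Equiv.Perm (Fin r), ∏ k, L k (v (π k)) := by
  let m : E [×r]→L[𝕜] 𝔸 :=
    (ContinuousMultilinearMap.mkPiAlgebra 𝕜 (Fin r) 𝔸).compContinuousLinearMap L
  let F (z : E) : 𝔸 := m fun _ ↦ z
  have hF : (∏ k, fun z ↦ L k (z - p)) = fun z ↦ F (z - p) := by
    ext z
    simp [F, m]
  rw [hF, iteratedFDeriv_comp_sub, m.iteratedFDeriv_comp_diagonal]
  simp [m]

theorem iteratedFDeriv_prod_of_eq_zero {r : ℕ} {f : Fin r → E → 𝔸}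
    (hf : ∀ k, ContDiffAt 𝕜 ∞ (f k) p) (hfp : ∀ k, f k p = 0) (v : Fin r → E) :
    iteratedFDeriv 𝕜 r (∏ k, f k) p v =
      ∑ π : Equiv.Perm (Fin r), ∏ k, fderiv 𝕜 (f k) p (v (π k)) := by
  let l (k : Fin r) (z : E) : 𝔸 := fderiv 𝕜 (f k) p (z - p)
  have hl (k : Fin r) : ContDiffAt 𝕜 ∞ (l k) p := by fun_prop
  have hsub : ∏ k, f k - ∏ k, l k ∈ vanishingSubgroup 𝕜 𝔸 p (Finset.univ.card + 1) :=
    prod_sub_prod_mem_of_sub_mem _ _ (fun k _ ↦ .of_eq_zero (hf k) (hfp k))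
      (fun k _ ↦ .of_eq_zero (hl k) (by simp [l]))
      fun k _ ↦ vanishesToOrder_sub_fderiv (hf k) (hfp k)
  have hlr : ContDiffAt 𝕜 r (∏ k, l k) p := by
    rw [Finset.prod_fn]
    exact contDiffAt_prod fun k _ ↦ (hl k).of_le (mod_cast le_top)
  rw [← iteratedFDeriv_prod_clm, ← sub_add_cancel (∏ k, f k) (∏ k, l k),
    iteratedFDeriv_add_apply (hsub.1.of_le (mod_cast le_top)) hlr,
    hsub.2 r (by simp), zero_add]

end Vanishing

/-! ### Hadamard's lemma -/

section Hadamard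

variable {E G : Type*} [NormedAddCommGroup E] [NormedSpace ℝ E] [NormedAddCommGroup G]
  [NormedSpace ℝ G] {n : ℕ∞}

open MeasureTheory in
theorem contDiff_intervalIntegral {h : E → ℝ → G} (hh : ContDiff ℝ n (Function.uncurry h))
    (a b : ℝ) : ContDiff ℝ n fun z ↦ ∫ t in a..b, h z t := by
  wlog hab : a ≤ b generalizing a b
  · simpa only [intervalIntegral.integral_symm b a] using (this b a (le_of_not_ge hab)).neg
  -- The integral is the value at `0` of the convolution of the indicator of `(a, b]` with
  -- `s ↦ h z (-s)`, where the latter may be cut off outside a large ball.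
  let R : ℝ := max |a| |b| + 1
  let ρ : ContDiffBump (0 : ℝ) := ⟨R, R + 1, by positivity, lt_add_one R⟩
  let g : E → ℝ → G := fun z s ↦ ρ s • h z (-s)
  let φ : ℝ → ℝ := (Set.Ioc a b).indicator 1
  have hφ : LocallyIntegrable φ volume :=
    ((integrable_indicator_iff measurableSet_Ioc).2
      (integrableOn_const (by simp))).locallyIntegrable
  have hg : ContDiff ℝ n (Function.uncurry g) :=
    (ρ.contDiff.comp contDiff_snd).smul (hh.comp (contDiff_fst.prodMk contDiff_snd.neg))
  have hgρ (z : E) (s : ℝ) (_ : z ∈ Set.univ) (hs : s ∉ Metric.closedBall 0 (R + 1)) :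
      g z s = 0 := by
    have : ρ s = 0 := ρ.zero_of_le_dist (not_le.1 hs).le
    rw [show g z s = ρ s • h z (-s) from rfl, this, zero_smul]
  have hconv : ContDiffOn ℝ n
      (fun z ↦ convolution φ (g z) (ContinuousLinearMap.lsmul ℝ ℝ) volume 0) Set.univ :=
    contDiffOn_convolution_right_with_param_comp _ contDiffOn_const isOpen_univ
      (isCompact_closedBall _ _) hgρ hφ hg.contDiffOn
  rw [contDiffOn_univ] at hconv
  convert hconv using 2 with z
  rw [intervalIntegral.integral_of_le hab, ← integral_indicator measurableSet_Ioc, convolution]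
  congr 1
  ext t
  by_cases ht : t ∈ Set.Ioc a b
  · have hρ : ρ (-t) = 1 := ρ.one_of_mem_closedBall <| by
      rw [Metric.mem_closedBall, dist_zero_right, norm_neg, Real.norm_eq_abs]
      exact (abs_le_max_abs_abs ht.1.le ht.2).trans (lt_add_one _).le
    simp [φ, ht, g, hρ]
  · simp [φ, ht]

theorem exists_contDiff_eq_add_apply_sub [CompleteSpace G] {F : E → G}
    (hF : ContDiff ℝ (n + 1) F) (p : E) :
    ∃ g : E → E →L[ℝ] G, ContDiff ℝ n g ∧ g p = fderiv ℝ F p ∧ ∀ z, F z = F p + g z (z - p) := by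
  have hF' : ContDiff ℝ n (fderiv ℝ F) := hF.fderiv_right le_rfl
  refine ⟨fun z ↦ ∫ t in (0 : ℝ)..1, fderiv ℝ F (p + t • (z - p)),
    contDiff_intervalIntegral (h := fun z t ↦ fderiv ℝ F (p + t • (z - p)))
      (hF'.comp (by fun_prop)) 0 1, by simp, fun z ↦ ?_⟩
  have hcont : Continuous fun t : ℝ ↦ fderiv ℝ F (p + t • (z - p)) :=
    hF'.continuous.comp (by fun_prop)
  have hderiv (t : ℝ) : HasDerivAt (fun t : ℝ ↦ F (p + t • (z - p)))
      (fderiv ℝ F (p + t • (z - p)) (z - p)) t :=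
    (hF.differentiable (by simp) _).hasFDerivAt.comp_hasDerivAt t <| by
      simpa using ((hasDerivAt_id t).smul_const (z - p)).const_add p
  rw [ContinuousLinearMap.intervalIntegral_apply (hcont.intervalIntegrable _ _),
    intervalIntegral.integral_eq_sub_of_hasDerivAt (fun t _ ↦ hderiv t)
      ((hcont.clm_apply continuous_const).intervalIntegrable _ _)]
  simp

theorem exists_contDiff_eq_add_sum_coord_smul [CompleteSpace G] {ι : Type*} [Fintype ι]
    (b : Module.Basis ι ℝ E) {F : E → G} (hF : ContDiff ℝ (n + 1) F) (p : E) :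
    ∃ g : ι → E → G, (∀ i, ContDiff ℝ n (g i)) ∧ (∀ i, g i p = fderiv ℝ F p (b i)) ∧
      ∀ z, F z = F p + ∑ i, b.coord i (z - p) • g i z := by
  obtain ⟨g, hg, hgp, hgF⟩ := exists_contDiff_eq_add_apply_sub hF p
  refine ⟨fun i z ↦ g z (b i), fun i ↦ hg.clm_apply contDiff_const, fun i ↦ by simp only [hgp],
    fun z ↦ ?_⟩
  rw [hgF z]
  nth_rw 1 [← b.sum_repr (z - p)]
  simp only [map_sum, map_smul, Module.Basis.coord_apply]

end Hadamard

/-! ### Functions read in charts -/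

section Charts

variable {E : Type*} [NormedAddCommGroup E] [NormedSpace ℝ E]
  {M : Type*} [TopologicalSpace M] [ChartedSpace E M]
  {G : Type*} [NormedAddCommGroup G] [NormedSpace ℝ G]
  {e : OpenPartialHomeomorph M E} {x : M}

theorem eventuallyEq_comp_symm_comp {X Y Z : Type*} [TopologicalSpace X] [TopologicalSpace Y]
    {e : OpenPartialHomeomorph X Y} {x : X} (hx : x ∈ e.source) (g : X → Z) :
    (g ∘ e.symm) ∘ e =ᶠ[nhds x] g := by
  filter_upwards [e.open_source.mem_nhds hx] with y hy
  simp only [Function.comp_apply, e.left_inv hy]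

theorem mvfderiv_congr {f g : M → G} (h : f =ᶠ[nhds x] g) :
    mvfderiv 𝓘(ℝ, E) f x = mvfderiv 𝓘(ℝ, E) g x := by
  ext v
  exact congrArg (fun A : E →L[ℝ] G ↦ A v) h.mfderiv_eq

theorem mdifferentiableAt_chart (he : e ∈ IsManifold.maximalAtlas 𝓘(ℝ, E) ∞ M)
    (hx : x ∈ e.source) : MDifferentiableAt 𝓘(ℝ, E) 𝓘(ℝ, E) e x :=
  (contMDiffAt_of_mem_maximalAtlas he hx).mdifferentiableAt (by simp)

theorem mvfderiv_comp_chart (he : e ∈ IsManifold.maximalAtlas 𝓘(ℝ, E) ∞ M) (hx : x ∈ e.source)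
    {h : E → G} (hh : DifferentiableAt ℝ h (e x)) (v : TangentSpace 𝓘(ℝ, E) x) :
    mvfderiv 𝓘(ℝ, E) (h ∘ e) x v = fderiv ℝ h (e x) (mvfderiv 𝓘(ℝ, E) e x v) := by
  have := mfderiv_comp_apply x hh.mdifferentiableAt (mdifferentiableAt_chart he hx) v
  rwa [mfderiv_eq_fderiv] at this

theorem contDiffAt_comp_chart_symm (he : e ∈ IsManifold.maximalAtlas 𝓘(ℝ, E) ∞ M)
    (hx : x ∈ e.source) {g : M → G} (hg : ContMDiffAt 𝓘(ℝ, E) 𝓘(ℝ, G) ∞ g x) :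
    ContDiffAt ℝ ∞ (g ∘ e.symm) (e x) := by
  have hsymm : ContMDiffAt 𝓘(ℝ, E) 𝓘(ℝ, E) ∞ e.symm (e x) :=
    contMDiffAt_symm_of_mem_maximalAtlas he (e.map_source hx)
  exact contMDiffAt_iff_contDiffAt.1 (ContMDiffAt.comp (e x) (by rwa [e.left_inv hx]) hsymm)

theorem differentiableAt_comp_chart_symm (he : e ∈ IsManifold.maximalAtlas 𝓘(ℝ, E) ∞ M)
    (hx : x ∈ e.source) {g : M → G} (hg : MDifferentiableAt 𝓘(ℝ, E) 𝓘(ℝ, G) g x) :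
    DifferentiableAt ℝ (g ∘ e.symm) (e x) := by
  have hsymm : MDifferentiableAt 𝓘(ℝ, E) 𝓘(ℝ, E) e.symm (e x) :=
    (contMDiffAt_symm_of_mem_maximalAtlas he (e.map_source hx)).mdifferentiableAt (by simp)
  exact mdifferentiableAt_iff_differentiableAt.1
    (MDifferentiableAt.comp (e x) (by rwa [e.left_inv hx]) hsymm)

theorem mvfderiv_eq_fderiv_chart (he : e ∈ IsManifold.maximalAtlas 𝓘(ℝ, E) ∞ M)
    (hx : x ∈ e.source) {g : M → G} (hg : MDifferentiableAt 𝓘(ℝ, E) 𝓘(ℝ, G) g x)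
    (v : TangentSpace 𝓘(ℝ, E) x) :
    mvfderiv 𝓘(ℝ, E) g x v = fderiv ℝ (g ∘ e.symm) (e x) (mvfderiv 𝓘(ℝ, E) e x v) := by
  rw [← mvfderiv_comp_chart he hx (differentiableAt_comp_chart_symm he hx hg),
    mvfderiv_congr (eventuallyEq_comp_symm_comp hx g)]

theorem contMDiffAt_comp_chart (he : e ∈ IsManifold.maximalAtlas 𝓘(ℝ, E) ∞ M)
    (hx : x ∈ e.source) {h : E → G} (hh : ContDiffAt ℝ ∞ h (e x)) :
    ContMDiffAt 𝓘(ℝ, E) 𝓘(ℝ, G) ∞ (h ∘ e) x :=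
  hh.contMDiffAt.comp x (contMDiffAt_of_mem_maximalAtlas he hx)

/-- The differential of a chart at a point of its domain, as a linear equivalence. -/
def chartEquiv (he : e ∈ IsManifold.maximalAtlas 𝓘(ℝ, E) ∞ M) (hx : x ∈ e.source) :
    TangentSpace 𝓘(ℝ, E) x ≃ₗ[ℝ] E :=
  LinearEquiv.ofBijective (mvfderiv 𝓘(ℝ, E) e x).toLinearMap <| by
    have hdiff : e.MDifferentiable 𝓘(ℝ, E) 𝓘(ℝ, E) :=
      ⟨(contMDiffOn_of_mem_maximalAtlas he).mdifferentiableOn (by simp),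
        (contMDiffOn_symm_of_mem_maximalAtlas he).mdifferentiableOn (by simp)⟩
    exact hdiff.mfderiv_bijective hx

theorem chartEquiv_apply (he : e ∈ IsManifold.maximalAtlas 𝓘(ℝ, E) ∞ M) (hx : x ∈ e.source)
    (v : TangentSpace 𝓘(ℝ, E) x) : chartEquiv he hx v = mvfderiv 𝓘(ℝ, E) e x v := rfl

variable [IsManifold 𝓘(ℝ, E) ∞ M]

theorem mvfderiv_chartAt_self (x : M) (v : TangentSpace 𝓘(ℝ, E) x) :
    mvfderiv 𝓘(ℝ, E) (chartAt E x) x v = v := by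
  have h := mfderiv_extChartAt_self (I := 𝓘(ℝ, E)) (x := x)
  rw [extChartAt_coe] at h
  exact congrArg (fun A ↦ A v) h

variable [FiniteDimensional ℝ E] [T2Space M]

theorem exists_contMDiff_eventuallyEq {g : M → G} {U : Set M} (hU : U ∈ nhds x)
    (hg : ∀ y ∈ U, ContMDiffAt 𝓘(ℝ, E) 𝓘(ℝ, G) ∞ g y) :
    ∃ h : M → G, ContMDiff 𝓘(ℝ, E) 𝓘(ℝ, G) ∞ h ∧ h =ᶠ[nhds x] g := by
  obtain ⟨χ, -, hχ⟩ := (SmoothBumpFunction.nhds_basis_tsupport (I := 𝓘(ℝ, E)) x).mem_iff.1 hU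
  refine ⟨fun y ↦ χ y • g y, contMDiff_of_tsupport fun y hy ↦ ?_, ?_⟩
  · exact χ.contMDiffAt.smul (hg y (hχ (tsupport_smul_subset_left _ _ hy)))
  · filter_upwards [χ.eventuallyEq_one] with y hy
    rw [hy, Pi.one_apply, one_smul]

end Charts

/-! ### Ideals of functions that vanish at a point -/

section Ideals

variable {E : Type*} [NormedAddCommGroup E] [NormedSpace ℝ E]
  {M : Type*} [TopologicalSpace M] [ChartedSpace E M] {x : M}

variable (E) in
/-- Evaluation of smooth functions at `x`, as a homomorphism of algebras with kernel `𝔪_x`. -/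
def evalAt (x : M) : SmoothFun E M →ₐ[ℂ] ℂ :=
  (Pi.evalAlgHom ℂ (fun _ : M ↦ ℂ) x).comp (SmoothFun E M).val

theorem evalAt_apply (x : M) (f : SmoothFun E M) : evalAt E x f = (f : M → ℂ) x := rfl

theorem mem_idealAt {f : SmoothFun E M} : f ∈ idealAt E x ↔ (f : M → ℂ) x = 0 :=
  RingHom.mem_ker

theorem sub_algebraMap_mem_idealAt (f : SmoothFun E M) (x : M) :
    f - algebraMap ℂ (SmoothFun E M) ((f : M → ℂ) x) ∈ idealAt E x :=
  mem_idealAt.2 (sub_self ((f : M → ℂ) x))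

theorem prod_mem_idealAt_pow {r : ℕ} {f : Fin r → SmoothFun E M}
    (hf : ∀ k, f k ∈ idealAt E x) : ∏ k, f k ∈ idealAt E x ^ r := by
  simpa only [Finset.prod_const, Finset.card_univ, Fintype.card_fin] using
    Ideal.prod_mem_prod (s := Finset.univ) (I := fun _ : Fin r ↦ idealAt E x) fun k _ ↦ hf k

theorem idealAt_pow_induction {r : ℕ} {C : SmoothFun E M → Prop}
    (add : ∀ f g, C f → C g → C (f + g)) (smul : ∀ (c : ℂ) f, C f → C (c • f))
    (pow_succ : ∀ f ∈ idealAt E x ^ (r + 1), C f)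
    (prod : ∀ f : Fin r → SmoothFun E M, (∀ k, f k ∈ idealAt E x) → C (∏ k, f k)) :
    ∀ f ∈ idealAt E x ^ r, C f := by
  refine ideal_pow_induction _ r add fun a f hf ↦ ?_
  have split : a * ∏ k, f k = (a - algebraMap ℂ (SmoothFun E M) ((a : M → ℂ) x)) * ∏ k, f k +
      (a : M → ℂ) x • ∏ k, f k := by
    rw [Algebra.smul_def]; ring
  rw [split]
  refine add _ _ (pow_succ _ ?_) (smul _ _ (prod f hf))
  rw [_root_.pow_succ']
  exact Ideal.mul_mem_mul (sub_algebraMap_mem_idealAt a x) (prod_mem_idealAt_pow hf)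

theorem contMDiff_coe (f : SmoothFun E M) : ContMDiff 𝓘(ℝ, E) 𝓘(ℝ, ℂ) ∞ (f : M → ℂ) := f.2

theorem mdifferentiableAt_coe (f : SmoothFun E M) (x : M) :
    MDifferentiableAt 𝓘(ℝ, E) 𝓘(ℝ, ℂ) (f : M → ℂ) x :=
  (contMDiff_coe f).contMDiffAt.mdifferentiableAt (by simp)

theorem contDiffAt_coe_comp_symm {e : OpenPartialHomeomorph M E}
    (he : e ∈ IsManifold.maximalAtlas 𝓘(ℝ, E) ∞ M) (hx : x ∈ e.source) (f : SmoothFun E M) :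
    ContDiffAt ℝ ∞ ((f : M → ℂ) ∘ e.symm) (e x) :=
  contDiffAt_comp_chart_symm he hx (contMDiff_coe f).contMDiffAt

theorem mvfderiv_coe_const_smul [IsManifold 𝓘(ℝ, E) ∞ M] (c : ℂ) (f : SmoothFun E M) (x : M)
    (v : TangentSpace 𝓘(ℝ, E) x) :
    mvfderiv 𝓘(ℝ, E) ((c • f : SmoothFun E M) : M → ℂ) x v =
      c • mvfderiv 𝓘(ℝ, E) (f : M → ℂ) x v := by
  have he : chartAt E x ∈ IsManifold.maximalAtlas 𝓘(ℝ, E) ∞ M :=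
    IsManifold.chart_mem_maximalAtlas x
  have hx := mem_chart_source E x
  have hcomp : ((c • f : SmoothFun E M) : M → ℂ) ∘ (chartAt E x).symm =
      c • ((f : M → ℂ) ∘ (chartAt E x).symm) := rfl
  rw [mvfderiv_eq_fderiv_chart he hx (mdifferentiableAt_coe _ x), hcomp,
    fderiv_const_smul (differentiableAt_comp_chart_symm he hx (mdifferentiableAt_coe f x)),
    _root_.smul_apply, ← mvfderiv_eq_fderiv_chart he hx (mdifferentiableAt_coe f x)]

/-- The differential at `x` of smooth functions, with values in the complex covectors at `x`. -/
def differentialAt [IsManifold 𝓘(ℝ, E) ∞ M] (x : M) :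
    SmoothFun E M →ₗ[ℂ] TangentSpace 𝓘(ℝ, E) x →ₗ[ℝ] ℂ where
  toFun f := (mvfderiv 𝓘(ℝ, E) (f : M → ℂ) x).toLinearMap
  map_add' f g := congrArg ContinuousLinearMap.toLinearMap
    (mvfderiv_add (mdifferentiableAt_coe f x) (mdifferentiableAt_coe g x))
  map_smul' c f := LinearMap.ext (mvfderiv_coe_const_smul c f x)

theorem differentialAt_apply [IsManifold 𝓘(ℝ, E) ∞ M] (f : SmoothFun E M)
    (v : TangentSpace 𝓘(ℝ, E) x) :
    differentialAt x f v = mvfderiv 𝓘(ℝ, E) (f : M → ℂ) x v := rfl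

variable [IsManifold 𝓘(ℝ, E) ∞ M] [FiniteDimensional ℝ E] [T2Space M]

theorem exists_smoothFun_eventuallyEq_comp_chart {e : OpenPartialHomeomorph M E}
    (he : e ∈ IsManifold.maximalAtlas 𝓘(ℝ, E) ∞ M) (hx : x ∈ e.source) {h : E → ℂ}
    (hh : ContDiff ℝ ∞ h) : ∃ f : SmoothFun E M, (f : M → ℂ) =ᶠ[nhds x] h ∘ e := by
  obtain ⟨f, hf, heq⟩ := exists_contMDiff_eventuallyEq (e.open_source.mem_nhds hx)
    fun y hy ↦ contMDiffAt_comp_chart he hy hh.contDiffAt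
  exact ⟨⟨f, hf⟩, heq⟩

theorem mem_idealAt_pow_of_eventuallyEq_zero {f : SmoothFun E M}
    (hf : (f : M → ℂ) =ᶠ[nhds x] 0) (n : ℕ) : f ∈ idealAt E x ^ n := by
  obtain ⟨χ, -, hχ⟩ := (SmoothBumpFunction.nhds_basis_tsupport (I := 𝓘(ℝ, E)) x).mem_iff.1 hf
  let u : SmoothFun E M := ⟨fun y ↦ 1 - χ y,
    contMDiff_const.sub (Complex.ofRealCLM.contDiff.contMDiff.comp χ.contMDiff)⟩
  have hu : u ∈ idealAt E x := mem_idealAt.2 (by simp [u])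
  have hfu : f * u = f := by
    ext y
    change (f : M → ℂ) y * (1 - χ y) = (f : M → ℂ) y
    by_cases hy : y ∈ tsupport χ
    · rw [show (f : M → ℂ) y = 0 from hχ hy, zero_mul]
    · rw [image_eq_zero_of_notMem_tsupport hy, Complex.ofReal_zero, sub_zero, mul_one]
  have hfun : f * u ^ n = f := by
    induction n with
    | zero => rw [pow_zero, mul_one]
    | succ n ih => rw [pow_succ, ← mul_assoc, ih, hfu]
  exact hfun ▸ Ideal.mul_mem_left _ _ (Ideal.pow_mem_pow hu n)

theorem mem_idealAt_sq_of_eventuallyEq_sum {ι : Type*} [Fintype ι] {e : OpenPartialHomeomorph M E}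
    (he : e ∈ IsManifold.maximalAtlas 𝓘(ℝ, E) ∞ M) (hx : x ∈ e.source) {f : SmoothFun E M}
    {g h : ι → E → ℂ} (hg : ∀ i, ContDiff ℝ ∞ (g i)) (hh : ∀ i, ContDiff ℝ ∞ (h i))
    (hg0 : ∀ i, g i (e x) = 0) (hh0 : ∀ i, h i (e x) = 0)
    (hf : (f : M → ℂ) =ᶠ[nhds x] fun y ↦ ∑ i, g i (e y) * h i (e y)) :
    f ∈ idealAt E x ^ 2 := by
  choose u hu using fun i ↦ exists_smoothFun_eventuallyEq_comp_chart he hx (hg i)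
  choose w hw using fun i ↦ exists_smoothFun_eventuallyEq_comp_chart he hx (hh i)
  have hsum : ∑ i, u i * w i ∈ idealAt E x ^ 2 := by
    rw [pow_two]
    exact Ideal.sum_mem _ fun i _ ↦ Ideal.mul_mem_mul
      (mem_idealAt.2 ((hu i).eq_of_nhds.trans (hg0 i)))
      (mem_idealAt.2 ((hw i).eq_of_nhds.trans (hh0 i)))
  have hzero : ((f - ∑ i, u i * w i : SmoothFun E M) : M → ℂ) =ᶠ[nhds x] 0 := by
    filter_upwards [hf, Filter.eventually_all.2 hu, Filter.eventually_all.2 hw] with y hfy huy hwy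
    simp [hfy, huy, hwy, AddSubmonoidClass.coe_finsetSum, Finset.sum_apply]
  simpa only [sub_add_cancel] using
    Ideal.add_mem _ (mem_idealAt_pow_of_eventuallyEq_zero hzero 2) hsum

theorem mem_idealAt_sq {f : SmoothFun E M} (hf : f ∈ idealAt E x)
    (hdf : differentialAt x f = 0) : f ∈ idealAt E x ^ 2 := by
  have he : chartAt E x ∈ IsManifold.maximalAtlas 𝓘(ℝ, E) ∞ M :=
    IsManifold.chart_mem_maximalAtlas x
  have hx := mem_chart_source E x
  obtain ⟨F, hFs, hF⟩ := exists_contMDiff_eventuallyEq (E := E) (x := chartAt E x x)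
    (g := (f : M → ℂ) ∘ (chartAt E x).symm)
    ((chartAt E x).open_target.mem_nhds ((chartAt E x).map_source hx)) fun z hz ↦ by
      have := contDiffAt_coe_comp_symm he ((chartAt E x).map_target hz) f
      rw [(chartAt E x).right_inv hz] at this
      exact this.contMDiffAt
  have hFf : F ∘ chartAt E x =ᶠ[nhds x] f :=
    (hF.comp_tendsto ((chartAt E x).continuousAt hx)).trans
      (eventuallyEq_comp_symm_comp hx (f : M → ℂ))
  have hF0 : F (chartAt E x x) = 0 := hFf.eq_of_nhds.trans (mem_idealAt.1 hf)
  have hdF : fderiv ℝ F (chartAt E x x) = 0 := by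
    ext w
    obtain ⟨v, rfl⟩ := (chartEquiv he hx).surjective w
    rw [hF.fderiv_eq, chartEquiv_apply,
      ← mvfderiv_eq_fderiv_chart he hx (mdifferentiableAt_coe f x)]
    exact LinearMap.congr_fun hdf v
  let b := Module.finBasis ℝ E
  obtain ⟨g, hgs, hgp, hFg⟩ :=
    exists_contDiff_eq_add_sum_coord_smul (n := ⊤) b (contMDiff_iff_contDiff.1 hFs) (chartAt E x x)
  refine mem_idealAt_sq_of_eventuallyEq_sum he hx
    (g := fun i z ↦ (b.coord i (z - chartAt E x x) : ℂ)) (fun i ↦ ?_) hgs (by simp)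
    (fun i ↦ by rw [hgp, hdF, _root_.zero_apply]) ?_
  · exact (Complex.ofRealCLM ∘L (b.coord i).toContinuousLinearMap).contDiff.comp
      (contDiff_id.sub contDiff_const)
  · filter_upwards [hFf] with y hy
    rw [← hy, Function.comp_apply, hFg, hF0, zero_add]
    simp only [Complex.real_smul]

theorem sub_mem_idealAt_sq {f g : SmoothFun E M} (hf : f ∈ idealAt E x) (hg : g ∈ idealAt E x)
    (h : differentialAt x f = differentialAt x g) : f - g ∈ idealAt E x ^ 2 :=
  mem_idealAt_sq ((idealAt E x).sub_mem hf hg) (by rw [map_sub, h, sub_self])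

end Ideals

/-! ### Contraction -/

theorem multilinearMap_sum_smul {R V W κ ι : Type*} [CommSemiring R] [AddCommMonoid V] [Module R V]
    [AddCommMonoid W] [Module R W] [DecidableEq κ] [Fintype κ] [Fintype ι]
    (T : MultilinearMap R (fun _ : κ ↦ V) W) (c : κ → ι → R) (w : ι → V) :
    T (fun k ↦ ∑ i, c k i • w i) = ∑ i : κ → ι, (∏ k, c k (i k)) • T fun k ↦ w (i k) := by
  simp only [T.map_sum, T.map_smul_univ]

/-- Real covectors as complex ones. -/
def ofRealDual (V : Type*) [AddCommGroup V] [Module ℝ V] : Module.Dual ℝ V →ₗ[ℝ] V →ₗ[ℝ] ℂ :=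
  Complex.ofRealCLM.toLinearMap.compRight ℝ

theorem ofRealDual_apply {V : Type*} [AddCommGroup V] [Module ℝ V] (ξ : Module.Dual ℝ V) (v : V) :
    ofRealDual V ξ v = (ξ v : ℂ) := rfl

theorem sum_smul_ofRealDual_coord {V ι : Type*} [AddCommGroup V] [Module ℝ V] [Fintype ι]
    (b : Module.Basis ι ℝ V) (ζ : V →ₗ[ℝ] ℂ) : ∑ i, ζ (b i) • ofRealDual V (b.coord i) = ζ :=
  b.ext fun j ↦ by
    classical
    simp [ofRealDual_apply, Finsupp.single_apply, apply_ite Complex.ofReal]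

section Contraction

variable {E : Type*} [NormedAddCommGroup E] [NormedSpace ℝ E] [FiniteDimensional ℝ E]
  {M : Type*} [TopologicalSpace M] [ChartedSpace E M] {r : ℕ} {x : M}

variable (E) in
/-- The basis of the tangent space that is used for contractions. -/
def tangentBasis (x : M) :
    Module.Basis (Fin (Module.finrank ℝ E)) ℝ (TangentSpace 𝓘(ℝ, E) x) :=
  Module.finBasis ℝ E

theorem contract_eq (Φ : ContraTensor E r x) (η : CoTensor E r x) :
    contract Φ η = ∑ i : Fin r → Fin (Module.finrank ℝ E),
      Φ (fun k ↦ (tangentBasis E x).coord (i k)) * η (fun k ↦ tangentBasis E x (i k)) :=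
  rfl

/-- The contraction as a bilinear map. -/
def contractₗ : ContraTensor E r x →ₗ[ℂ] CoTensor E r x →ₗ[ℂ] ℂ :=
  LinearMap.mk₂ ℂ contract
    (fun Φ Ψ η ↦ by simp only [contract_eq, _root_.add_apply, add_mul, Finset.sum_add_distrib])
    (fun c Φ η ↦ by
      simp only [contract_eq, _root_.smul_apply, smul_eq_mul, mul_assoc, Finset.mul_sum])
    (fun Φ η θ ↦ by simp only [contract_eq, Pi.add_apply, mul_add, Finset.sum_add_distrib])
    (fun c Φ η ↦ by
      simp only [contract_eq, Pi.smul_apply, smul_eq_mul, mul_left_comm, Finset.mul_sum])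

theorem contractₗ_apply (Φ : ContraTensor E r x) (η : CoTensor E r x) :
    contractₗ Φ η = contract Φ η := rfl

theorem contract_comp_perm {Φ : ContraTensor E r x}
    (hΦ : ∀ (π : Equiv.Perm (Fin r)) ξ, Φ (fun k ↦ ξ (π k)) = Φ ξ) (η : CoTensor E r x)
    (π : Equiv.Perm (Fin r)) : contract Φ (fun v ↦ η fun k ↦ v (π k)) = contract Φ η := by
  rw [contract_eq, contract_eq]
  refine Fintype.sum_equiv (Equiv.arrowCongr π.symm (Equiv.refl _)) _ _ fun i ↦ ?_
  rw [← hΦ π fun k ↦ (tangentBasis E x).coord (i k)]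
  rfl

theorem contract_sum_perm {Φ : ContraTensor E r x}
    (hΦ : ∀ (π : Equiv.Perm (Fin r)) ξ, Φ (fun k ↦ ξ (π k)) = Φ ξ) (η : CoTensor E r x) :
    contract Φ (fun v ↦ ∑ π : Equiv.Perm (Fin r), η fun k ↦ v (π k)) =
      r.factorial * contract Φ η := by
  have hsum : (fun v ↦ ∑ π : Equiv.Perm (Fin r), η fun k ↦ v (π k) : CoTensor E r x) =
      ∑ π : Equiv.Perm (Fin r), (fun v ↦ η fun k ↦ v (π k) : CoTensor E r x) := by
    ext v
    simp only [Finset.sum_apply]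
  rw [hsum, ← contractₗ_apply, map_sum]
  simp only [contractₗ_apply, contract_comp_perm hΦ, Finset.sum_const, Finset.card_univ,
    Fintype.card_perm, Fintype.card_fin, nsmul_eq_mul]

theorem contract_symmetrize {Φ : ContraTensor E r x}
    (hΦ : ∀ (π : Equiv.Perm (Fin r)) ξ, Φ (fun k ↦ ξ (π k)) = Φ ξ) (η : CoTensor E r x) :
    contract Φ (symmetrize η) = contract Φ η := by
  have hη : (symmetrize η : CoTensor E r x) = (r.factorial : ℂ)⁻¹ •
      (fun v ↦ ∑ π : Equiv.Perm (Fin r), η fun k ↦ v (π k) : CoTensor E r x) := rfl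
  rw [hη, ← contractₗ_apply, map_smul, contractₗ_apply, contract_sum_perm hΦ, smul_eq_mul,
    inv_mul_cancel_left₀ (Nat.cast_ne_zero.2 r.factorial_ne_zero)]

theorem contract_prod (Φ : ContraTensor E r x)
    (ξ : Fin r → Module.Dual ℝ (TangentSpace 𝓘(ℝ, E) x)) :
    contract Φ (fun v ↦ ∏ k, (ξ k (v k) : ℂ)) = Φ ξ := by
  let b := tangentBasis E x
  have hξ : ξ = fun k ↦ ∑ i, ξ k (b i) • b.coord i := by
    ext1 k
    exact (b.sum_dual_apply_smul_coord (ξ k)).symm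
  conv_rhs => rw [hξ, multilinearMap_sum_smul]
  simp only [contract_eq, Complex.real_smul, Complex.ofReal_prod, mul_comm, b]

theorem contract_eq_sum_basis {ι : Type*} [Fintype ι] (Φ : ContraTensor E r x)
    (η : MultilinearMap ℝ (fun _ : Fin r ↦ TangentSpace 𝓘(ℝ, E) x) ℂ)
    (b : Module.Basis ι ℝ (TangentSpace 𝓘(ℝ, E) x)) :
    contract Φ (fun v ↦ η v) =
      ∑ i : Fin r → ι, Φ (fun k ↦ b.coord (i k)) * η (fun k ↦ b (i k)) := by
  classical
  have hη : (fun v ↦ η v : CoTensor E r x) = ∑ i : Fin r → ι,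
      η (fun k ↦ b (i k)) • (fun v ↦ ∏ k, (b.coord (i k) (v k) : ℂ) : CoTensor E r x) := by
    ext v
    conv_lhs => rw [← funext fun k ↦ b.sum_repr (v k), multilinearMap_sum_smul]
    simp only [Finset.sum_apply, Pi.smul_apply, smul_eq_mul, Complex.real_smul,
      Complex.ofReal_prod, Module.Basis.coord_apply, mul_comm]
  rw [hη, ← contractₗ_apply, map_sum]
  simp only [map_smul, contractₗ_apply, contract_prod, smul_eq_mul, mul_comm]

theorem contract_comp_ofRealDual
    (T : MultilinearMap ℂ (fun _ : Fin r ↦ TangentSpace 𝓘(ℝ, E) x →ₗ[ℝ] ℂ) ℂ)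
    (ζ : Fin r → TangentSpace 𝓘(ℝ, E) x →ₗ[ℝ] ℂ) :
    contract ((T.restrictScalars ℝ).compLinearMap fun _ ↦ ofRealDual _)
      (fun v ↦ ∏ k, ζ k (v k)) = T ζ := by
  conv_rhs => rw [← funext fun k ↦ sum_smul_ofRealDual_coord (tangentBasis E x) (ζ k),
    multilinearMap_sum_smul]
  simp only [contract_eq, MultilinearMap.compLinearMap_apply, MultilinearMap.coe_restrictScalars,
    smul_eq_mul, mul_comm]

end Contraction

/-! ### Differentials of order `r` in a chart -/

section ChartDiff

variable {E : Type*} [NormedAddCommGroup E] [NormedSpace ℝ E]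
  {M : Type*} [TopologicalSpace M] [ChartedSpace E M]
  {e : OpenPartialHomeomorph M E} {x : M} {r : ℕ}

theorem vanishesToOrder_of_mem_idealAt_pow (he : e ∈ IsManifold.maximalAtlas 𝓘(ℝ, E) ∞ M)
    (hx : x ∈ e.source) {k : ℕ} {f : SmoothFun E M} (hf : f ∈ idealAt E x ^ k) :
    VanishesToOrder ℝ k ((f : M → ℂ) ∘ e.symm) (e x) := by
  induction k generalizing f with
  | zero => exact .of_contDiffAt (contDiffAt_coe_comp_symm he hx f)
  | succ k ih =>
    rw [pow_succ] at hf
    refine Submodule.mul_induction_on hf (fun g hg m hm ↦ ?_) fun f g hf hg ↦ hf.add hg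
    have hm0 : ((m : M → ℂ) ∘ e.symm) (e x) = 0 := by
      rw [Function.comp_apply, e.left_inv hx, mem_idealAt.1 hm]
    exact (ih hg).bilinear (ContinuousLinearMap.mul ℝ ℂ)
      (.of_eq_zero (contDiffAt_coe_comp_symm he hx m) hm0)

theorem chartDiff_add (he : e ∈ IsManifold.maximalAtlas 𝓘(ℝ, E) ∞ M) (hx : x ∈ e.source)
    (f g : SmoothFun E M) :
    chartDiff e r ((f + g : SmoothFun E M) : M → ℂ) x = chartDiff e r f x + chartDiff e r g x :=
  funext fun v ↦ congrArg (fun m ↦ m fun k ↦ mvfderiv 𝓘(ℝ, E) e x (v k)) <|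
    iteratedFDeriv_add_apply (𝕜 := ℝ) (i := r)
      ((contDiffAt_coe_comp_symm he hx f).of_le (mod_cast le_top))
      ((contDiffAt_coe_comp_symm he hx g).of_le (mod_cast le_top))

theorem chartDiff_const_smul (he : e ∈ IsManifold.maximalAtlas 𝓘(ℝ, E) ∞ M) (hx : x ∈ e.source)
    (c : ℂ) (f : SmoothFun E M) :
    chartDiff e r ((c • f : SmoothFun E M) : M → ℂ) x = c • chartDiff e r f x :=
  funext fun v ↦ congrArg (fun m ↦ m fun k ↦ mvfderiv 𝓘(ℝ, E) e x (v k)) <|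
    iteratedFDeriv_const_smul_apply (𝕜 := ℝ) (i := r) (a := c)
      ((contDiffAt_coe_comp_symm he hx f).of_le (mod_cast le_top))

theorem chartDiff_eq_zero (he : e ∈ IsManifold.maximalAtlas 𝓘(ℝ, E) ∞ M) (hx : x ∈ e.source)
    {f : SmoothFun E M} (hf : f ∈ idealAt E x ^ (r + 1)) : chartDiff e r f x = 0 := by
  ext v
  rw [chartDiff, (vanishesToOrder_of_mem_idealAt_pow he hx hf).2 r r.lt_succ_self]
  rfl

theorem chartDiff_prod [IsManifold 𝓘(ℝ, E) ∞ M] (he : e ∈ IsManifold.maximalAtlas 𝓘(ℝ, E) ∞ M)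
    (hx : x ∈ e.source) {f : Fin r → SmoothFun E M} (hf : ∀ k, f k ∈ idealAt E x) :
    chartDiff e r ((∏ k, f k : SmoothFun E M) : M → ℂ) x =
      fun v ↦ ∑ π : Equiv.Perm (Fin r), ∏ k, differentialAt x (f k) (v (π k)) := by
  have hprod : ((∏ k, f k : SmoothFun E M) : M → ℂ) ∘ e.symm =
      ∏ k, (f k : M → ℂ) ∘ e.symm := by
    ext z
    simp [SubmonoidClass.coe_finsetProd, Finset.prod_apply]
  ext v
  rw [chartDiff, hprod, iteratedFDeriv_prod_of_eq_zero
    (fun k ↦ contDiffAt_coe_comp_symm he hx (f k)) fun k ↦ by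
      rw [Function.comp_apply, e.left_inv hx, mem_idealAt.1 (hf k)]]
  simp only [differentialAt_apply, mvfderiv_eq_fderiv_chart he hx (mdifferentiableAt_coe _ x)]

end ChartDiff

/-! ### Functions with prescribed differential -/

section CoordFun

variable {E : Type*} [NormedAddCommGroup E] [NormedSpace ℝ E] [FiniteDimensional ℝ E]
  {M : Type*} [TopologicalSpace M] [ChartedSpace E M] [IsManifold 𝓘(ℝ, E) ∞ M]

variable (E) in
/-- A bump function centered at `x`. -/
def bumpAt (x : M) : SmoothBumpFunction 𝓘(ℝ, E) x :=
  Classical.choice inferInstance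

variable [T2Space M]

theorem contMDiff_bump_smul_chart {x : M} (χ : SmoothBumpFunction 𝓘(ℝ, E) x) (L : E →L[ℝ] ℂ) :
    ContMDiff 𝓘(ℝ, E) 𝓘(ℝ, ℂ) ∞ fun y ↦ χ y • L (chartAt E x y - chartAt E x x) :=
  χ.contMDiff_smul fun _ hy ↦ ContMDiffAt.contMDiffWithinAt <|
    contMDiffAt_comp_chart (IsManifold.chart_mem_maximalAtlas x) hy <|
      (L.contDiff.comp (contDiff_id.sub contDiff_const)).contDiffAt

variable (x : M) (ζ : TangentSpace 𝓘(ℝ, E) x →ₗ[ℝ] ℂ)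

/-- A smooth function that vanishes at `x` and has the differential `ζ` there, chosen linearly in
`ζ`: the function `ζ` in the preferred chart, cut off by a bump function. -/
def coordFun (x : M) : (TangentSpace 𝓘(ℝ, E) x →ₗ[ℝ] ℂ) →ₗ[ℂ] SmoothFun E M where
  toFun ζ := ⟨fun y ↦ bumpAt E x y • ζ (chartAt E x y - chartAt E x x : E),
    contMDiff_bump_smul_chart (bumpAt E x) (LinearMap.toContinuousLinearMap (E := E) ζ)⟩
  map_add' _ _ := Subtype.ext <| funext fun _ ↦ smul_add _ _ _
  map_smul' c ζ := Subtype.ext <| funext fun y ↦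
    smul_comm (bumpAt E x y) c (ζ (chartAt E x y - chartAt E x x : E))

theorem coordFun_mem_idealAt : coordFun x ζ ∈ idealAt E x := by
  refine mem_idealAt.2 (smul_eq_zero_of_right _ ?_)
  rw [sub_self]
  exact map_zero ζ

theorem differentialAt_coordFun : differentialAt x (coordFun x ζ) = ζ := by
  let L : E →L[ℝ] ℂ := LinearMap.toContinuousLinearMap (E := E) ζ
  have hL : HasFDerivAt (fun z ↦ L (z - chartAt E x x)) L (chartAt E x x) :=
    L.hasFDerivAt.comp _ ((hasFDerivAt_id _).sub_const _)
  have hcoord : (coordFun x ζ : M → ℂ) =ᶠ[nhds x]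
      (fun z ↦ L (z - chartAt E x x)) ∘ chartAt E x := by
    filter_upwards [(bumpAt E x).eventuallyEq_one] with y hy
    change bumpAt E x y • L (chartAt E x y - chartAt E x x) = _
    rw [hy, Pi.one_apply, one_smul, Function.comp_apply]
  ext v
  rw [differentialAt_apply, mvfderiv_congr hcoord,
    mvfderiv_comp_chart (IsManifold.chart_mem_maximalAtlas x) (mem_chart_source E x)
      hL.differentiableAt, hL.fderiv, mvfderiv_chartAt_self]
  rfl

end CoordFun

/-! ### Existence and uniqueness of symbols -/

section Symbol

theorem algHom_apply_prod_sub_algebraMap {R A ι : Type*} [CommRing R] [CommRing A] [Algebra R A]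
    [DecidableEq ι] (φ : A →ₐ[R] R) (P : A →ₗ[R] A) (s : Finset ι) (u : ι → A) :
    φ (P (∏ k ∈ s, (u k - algebraMap R A (φ (u k))))) =
      φ (∑ t ∈ s.powerset, (∏ k ∈ s \ t, -u k) * P (∏ k ∈ t, u k)) := by
  have hterm (t : Finset ι) : (∏ k ∈ t, u k) * ∏ k ∈ s \ t, algebraMap R A (-φ (u k)) =
      (∏ k ∈ s \ t, -φ (u k)) • ∏ k ∈ t, u k := by
    rw [← map_prod, mul_comm, Algebra.smul_def]
  simp only [sub_eq_add_neg, ← map_neg (algebraMap R A), Finset.prod_add, hterm, map_sum, map_smul,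
    smul_eq_mul, map_mul, map_prod, map_neg φ]

variable {E : Type*} [NormedAddCommGroup E] [NormedSpace ℝ E]
  {M : Type*} [TopologicalSpace M] [ChartedSpace E M]
  {r : ℕ} {P : SmoothFun E M →ₗ[ℂ] SmoothFun E M} {x : M}

theorem HasOrder.apply_eq (hP : HasOrder r P) {f g : SmoothFun E M}
    (h : f - g ∈ idealAt E x ^ (r + 1)) : (P f : M → ℂ) x = (P g : M → ℂ) x := by
  have hfg := mem_idealAt.1 (hP x _ h)
  rw [map_sub] at hfg
  exact sub_eq_zero.1 hfg

variable [IsManifold 𝓘(ℝ, E) ∞ M] [FiniteDimensional ℝ E]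

theorem contract_chartDiff_prod {e : OpenPartialHomeomorph M E}
    (he : e ∈ IsManifold.maximalAtlas 𝓘(ℝ, E) ∞ M) (hx : x ∈ e.source)
    (σ : SymTensorField E M r) {f : Fin r → SmoothFun E M} (hf : ∀ k, f k ∈ idealAt E x) :
    contract (σ.1 x) (chartDiff e r ((∏ k, f k : SmoothFun E M) : M → ℂ) x) = r.factorial *
      contract (σ.1 x) fun v ↦ ∏ k, differentialAt x (f k) (v k) := by
  rw [chartDiff_prod he hx hf]
  exact contract_sum_perm (σ.2.1 x) fun v ↦ ∏ k, differentialAt x (f k) (v k)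

theorem isSymbol_of_prod (hP : HasOrder r P) {σ : SymTensorField E M r}
    (h : ∀ (x : M) (f : Fin r → SmoothFun E M), (∀ k, f k ∈ idealAt E x) →
      (P (∏ k, f k) : M → ℂ) x = r.factorial *
        contract (σ.1 x) fun v ↦ ∏ k, differentialAt x (f k) (v k)) :
    IsSymbol r P σ := by
  refine ⟨hP, fun x f hf e he hx ↦ ?_⟩
  refine idealAt_pow_induction (C := fun f : SmoothFun E M ↦ (P f : M → ℂ) x =
    contract (σ.1 x) (chartDiff e r f x)) (fun f g h₁ h₂ ↦ ?_) (fun c f h₁ ↦ ?_) (fun f hf ↦ ?_)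
    (fun f hf ↦ ?_) f hf
  · rw [chartDiff_add he hx, ← contractₗ_apply, map_add (contractₗ _), contractₗ_apply,
      contractₗ_apply, ← h₁, ← h₂, map_add]
    rfl
  · rw [chartDiff_const_smul he hx, ← contractₗ_apply, map_smul (contractₗ _), contractₗ_apply,
      ← h₁, map_smul]
    rfl
  · rw [chartDiff_eq_zero he hx hf, ← contractₗ_apply, map_zero]
    exact mem_idealAt.1 (hP x f hf)
  · rw [contract_chartDiff_prod he hx σ hf, h x f hf]

variable [T2Space M]

theorem HasOrder.apply_prod_congr (hP : HasOrder r P) {f g : Fin r → SmoothFun E M}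
    (hf : ∀ k, f k ∈ idealAt E x) (hg : ∀ k, g k ∈ idealAt E x)
    (hfg : ∀ k, differentialAt x (f k) = differentialAt x (g k)) :
    (P (∏ k, f k) : M → ℂ) x = (P (∏ k, g k) : M → ℂ) x := by
  refine hP.apply_eq ?_
  simpa only [Finset.card_univ, Fintype.card_fin] using
    prod_sub_prod_mem_of_sub_mem (fun n ↦ idealAt E x ^ n) Finset.univ
      (fun k _ ↦ (pow_one (idealAt E x)).symm ▸ hf k)
      (fun k _ ↦ (pow_one (idealAt E x)).symm ▸ hg k)
      fun k _ ↦ sub_mem_idealAt_sq (hf k) (hg k) (hfg k)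

variable (r P) in
/-- The values of `P` at `x` on the products of `r` functions that vanish at `x`, as a multilinear
map of the differentials of the factors. -/
def leadingPart (x : M) : MultilinearMap ℂ (fun _ : Fin r ↦ TangentSpace 𝓘(ℝ, E) x →ₗ[ℝ] ℂ) ℂ :=
  ((evalAt E x).toLinearMap ∘ₗ P).compMultilinearMap
    ((MultilinearMap.mkPiAlgebra ℂ (Fin r) (SmoothFun E M)).compLinearMap fun _ ↦ coordFun x)

theorem leadingPart_apply (ζ : Fin r → TangentSpace 𝓘(ℝ, E) x →ₗ[ℝ] ℂ) :
    leadingPart r P x ζ = (P (∏ k, coordFun x (ζ k)) : M → ℂ) x := rfl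

theorem HasOrder.apply_prod (hP : HasOrder r P) {f : Fin r → SmoothFun E M}
    (hf : ∀ k, f k ∈ idealAt E x) :
    (P (∏ k, f k) : M → ℂ) x = leadingPart r P x fun k ↦ differentialAt x (f k) := by
  rw [leadingPart_apply]
  exact hP.apply_prod_congr hf (fun k ↦ coordFun_mem_idealAt x _)
    fun k ↦ (differentialAt_coordFun x _).symm

variable (r P) in
/-- The value at `x` of the symbol of order `r` of `P`. The factor `1 / r!` compensates for the
`r!` permutations in the `r`-th differential of a product. -/
def symbolAt (x : M) : ContraTensor E r x :=
  (r.factorial : ℂ)⁻¹ •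
    ((leadingPart r P x).restrictScalars ℝ).compLinearMap fun _ ↦ ofRealDual _

theorem symbolAt_apply (ξ : Fin r → Module.Dual ℝ (TangentSpace 𝓘(ℝ, E) x)) :
    symbolAt r P x ξ = (r.factorial : ℂ)⁻¹ * leadingPart r P x fun k ↦ ofRealDual _ (ξ k) :=
  rfl

theorem factorial_mul_contract_symbolAt (ζ : Fin r → TangentSpace 𝓘(ℝ, E) x →ₗ[ℝ] ℂ) :
    r.factorial * contract (symbolAt r P x) (fun v ↦ ∏ k, ζ k (v k)) = leadingPart r P x ζ := by
  rw [symbolAt, ← contractₗ_apply, map_smul, LinearMap.smul_apply, contractₗ_apply,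
    contract_comp_ofRealDual, smul_eq_mul,
    mul_inv_cancel_left₀ (Nat.cast_ne_zero.2 r.factorial_ne_zero)]

theorem symbolAt_comp_perm (π : Equiv.Perm (Fin r))
    (ξ : Fin r → Module.Dual ℝ (TangentSpace 𝓘(ℝ, E) x)) :
    symbolAt r P x (fun k ↦ ξ (π k)) = symbolAt r P x ξ := by
  simp only [symbolAt_apply, leadingPart_apply,
    Equiv.prod_comp π fun k ↦ coordFun x (ofRealDual _ (ξ k))]

theorem HasOrder.symbolAt_eq (hP : HasOrder r P)
    {ξ : Fin r → Module.Dual ℝ (TangentSpace 𝓘(ℝ, E) x)} {u : Fin r → SmoothFun E M}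
    (hu : ∀ k, differentialAt x (u k) = ofRealDual _ (ξ k)) :
    symbolAt r P x ξ = ((r.factorial : ℂ)⁻¹ • ∑ t ∈ Finset.univ.powerset,
      (∏ k ∈ Finset.univ \ t, -u k) * P (∏ k ∈ t, u k) : SmoothFun E M).1 x := by
  have hd (k : Fin r) :
      differentialAt x (u k - algebraMap ℂ (SmoothFun E M) (evalAt E x (u k))) =
        ofRealDual _ (ξ k) := by
    have hconst : differentialAt x (algebraMap ℂ (SmoothFun E M) (evalAt E x (u k))) = 0 :=
      congrArg ContinuousLinearMap.toLinearMap (mvfderiv_const (evalAt E x (u k)))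
    rw [map_sub, hconst, sub_zero, hu]
  have hexpand := algHom_apply_prod_sub_algebraMap (evalAt E x) P Finset.univ u
  rw [evalAt_apply, hP.apply_prod (f := fun k ↦ u k - algebraMap ℂ _ (evalAt E x (u k)))
    fun k ↦ sub_algebraMap_mem_idealAt (u k) x] at hexpand
  simp only [hd] at hexpand
  rw [symbolAt_apply, hexpand]
  rfl

theorem HasOrder.contMDiffAt_symbolAt (hP : HasOrder r P) {e : OpenPartialHomeomorph M E}
    (he : e ∈ IsManifold.maximalAtlas 𝓘(ℝ, E) ∞ M) (hx : x ∈ e.source)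
    (ℓ : Fin r → Module.Dual ℝ E) :
    ContMDiffAt 𝓘(ℝ, E) 𝓘(ℝ, ℂ) ∞
      (fun y ↦ symbolAt r P y fun k ↦ (ℓ k).comp (mvfderiv 𝓘(ℝ, E) e y).toLinearMap) x := by
  let L (k : Fin r) : E →L[ℝ] ℂ := (ofRealDual E (ℓ k)).toContinuousLinearMap
  choose u hu using fun k ↦ exists_smoothFun_eventuallyEq_comp_chart he hx (L k).contDiff
  refine (contMDiff_coe ((r.factorial : ℂ)⁻¹ • ∑ t ∈ Finset.univ.powerset,
    (∏ k ∈ Finset.univ \ t, -u k) * P (∏ k ∈ t, u k))).contMDiffAt.congr_of_eventuallyEq ?_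
  filter_upwards [e.open_source.mem_nhds hx,
    Filter.eventually_all.2 fun k ↦ (hu k).eventuallyEq_nhds] with y hy huy
  refine hP.symbolAt_eq (u := u) fun k ↦ LinearMap.ext fun v ↦ ?_
  rw [differentialAt_apply, mvfderiv_congr (huy k),
    mvfderiv_comp_chart he hy (L k).differentiableAt, (L k).fderiv]
  rfl

/-- The symbol of order `r` of an operator of order `r`. -/
def symbol (hP : HasOrder r P) : SymTensorField E M r :=
  ⟨symbolAt r P, fun _ π ξ ↦ symbolAt_comp_perm π ξ, fun _ he ℓ _ hx ↦
    (hP.contMDiffAt_symbolAt he hx ℓ).contMDiffWithinAt⟩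

theorem isSymbol_symbol (hP : HasOrder r P) : IsSymbol r P (symbol hP) :=
  isSymbol_of_prod hP fun _ _ hf ↦
    (hP.apply_prod hf).trans (factorial_mul_contract_symbolAt _).symm

theorem IsSymbol.leadingPart_ofRealDual {σ : SymTensorField E M r} (h : IsSymbol r P σ)
    (ξ : Fin r → Module.Dual ℝ (TangentSpace 𝓘(ℝ, E) x)) :
    leadingPart r P x (fun k ↦ ofRealDual _ (ξ k)) = r.factorial * σ.1 x ξ := by
  have hf (k : Fin r) : coordFun x (ofRealDual _ (ξ k)) ∈ idealAt E x := coordFun_mem_idealAt x _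
  have he := IsManifold.chart_mem_maximalAtlas (I := 𝓘(ℝ, E)) (n := ∞) x
  rw [leadingPart_apply, h.2 x _ (prod_mem_idealAt_pow hf) _ he (mem_chart_source E x),
    contract_chartDiff_prod he (mem_chart_source E x) σ hf]
  simp only [differentialAt_coordFun, ofRealDual_apply, contract_prod]

theorem IsSymbol.unique {σ τ : SymTensorField E M r} (hσ : IsSymbol r P σ) (hτ : IsSymbol r P τ) :
    σ = τ := by
  ext x ξ
  exact mul_left_cancel₀ (Nat.cast_ne_zero.2 r.factorial_ne_zero : (r.factorial : ℂ) ≠ 0)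
    ((hσ.leadingPart_ofRealDual ξ).symm.trans (hτ.leadingPart_ofRealDual ξ))

end Symbol

/-! ### Connections in charts -/

section Connection

open scoped Bundle

variable {E : Type*} [NormedAddCommGroup E] [NormedSpace ℝ E]
  {M : Type*} [TopologicalSpace M] [ChartedSpace E M] [IsManifold 𝓘(ℝ, E) ∞ M] {x₀ y : M}

variable (x₀) in
/-- The vector field `X` in the coordinates given by the chart at `x₀`, as a function on `M`. -/
def inChart (X : (z : M) → TangentSpace 𝓘(ℝ, E) z) (z : M) : E :=
  mvfderiv 𝓘(ℝ, E) (chartAt E x₀) z (X z)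

theorem trivializationAt_apply_snd (hy : y ∈ (chartAt E x₀).source) (v : TangentSpace 𝓘(ℝ, E) y) :
    (trivializationAt E (TangentSpace 𝓘(ℝ, E)) x₀ ⟨y, v⟩).2 =
      mvfderiv 𝓘(ℝ, E) (chartAt E x₀) y v := by
  have h := TangentBundle.continuousLinearMapAt_trivializationAt (I := 𝓘(ℝ, E)) hy
  rw [extChartAt_coe] at h
  have hv := DFunLike.congr_fun h v
  rwa [Bundle.Trivialization.continuousLinearMapAt_apply,
    Bundle.Trivialization.coe_linearMapAt_of_mem _ hy] at hv

theorem inChart_eventuallyEq (hy : y ∈ (chartAt E x₀).source)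
    (X : (z : M) → TangentSpace 𝓘(ℝ, E) z) :
    inChart x₀ X =ᶠ[nhds y] fun z ↦ (trivializationAt E (TangentSpace 𝓘(ℝ, E)) x₀ ⟨z, X z⟩).2 := by
  filter_upwards [(chartAt E x₀).open_source.mem_nhds hy] with z hz
  rw [inChart, trivializationAt_apply_snd hz]

theorem mdifferentiableAt_inChart (hy : y ∈ (chartAt E x₀).source)
    {X : (z : M) → TangentSpace 𝓘(ℝ, E) z} (hX : MDiffAt (T% X) y) :
    MDifferentiableAt 𝓘(ℝ, E) 𝓘(ℝ, E) (inChart x₀ X) y :=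
  (((trivializationAt E (TangentSpace 𝓘(ℝ, E)) x₀).mdifferentiableAt_section_iff
    𝓘(ℝ, E) X hy).1 hX).congr_of_eventuallyEq (inChart_eventuallyEq hy X)

theorem contMDiffAt_inChart (hy : y ∈ (chartAt E x₀).source)
    {X : (z : M) → TangentSpace 𝓘(ℝ, E) z} (hX : CMDiffAt ∞ (T% X) y) :
    ContMDiffAt 𝓘(ℝ, E) 𝓘(ℝ, E) ∞ (inChart x₀ X) y :=
  (((trivializationAt E (TangentSpace 𝓘(ℝ, E)) x₀).contMDiffAt_section_iff
    (n := ∞) (IB := 𝓘(ℝ, E)) hy).1 hX).congr_of_eventuallyEq (inChart_eventuallyEq hy X)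

theorem contMDiff_nabla_apply
    {nabla : CovariantDerivative 𝓘(ℝ, E) E (TangentSpace 𝓘(ℝ, E) : M → Type _)}
    (hsmooth : CovariantDerivative.ContMDiffCovariantDerivative nabla ∞)
    {X Y : (z : M) → TangentSpace 𝓘(ℝ, E) z} (hX : CMDiff ∞ (T% X)) (hY : CMDiff ∞ (T% Y)) :
    CMDiff ∞ (T% fun z ↦ nabla X z (Y z)) :=
  (contMDiffOn_univ.1 (hsmooth.contMDiff.contMDiff hX.contMDiffOn)).clm_bundle_apply hY

variable (nabla : CovariantDerivative 𝓘(ℝ, E) E (TangentSpace 𝓘(ℝ, E) : M → Type _))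

theorem mdifferentiableAt_sum_smul {ι : Type*} (s : Finset ι) {c : ι → M → ℝ}
    {Z : ι → (z : M) → TangentSpace 𝓘(ℝ, E) z} (hc : ∀ i, MDiffAt (c i) y)
    (hZ : ∀ i, MDiffAt (T% (Z i)) y) : MDiffAt (T% (∑ i ∈ s, c i • Z i)) y := by
  convert! MDifferentiableAt.sum_section (𝕜 := ℝ) (I := 𝓘(ℝ, E)) (s := s) (x₀ := y)
    (t := fun i ↦ c i • Z i) (fun i _ ↦ (hc i).smul_section (hZ i)) using 3
  rw [Finset.sum_apply]

theorem nabla_sum_smul {ι : Type*} (s : Finset ι) {c : ι → M → ℝ}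
    {Z : ι → (z : M) → TangentSpace 𝓘(ℝ, E) z} (hc : ∀ i, MDiffAt (c i) y)
    (hZ : ∀ i, MDiffAt (T% (Z i)) y) (v : TangentSpace 𝓘(ℝ, E) y) :
    nabla (∑ i ∈ s, c i • Z i) y v =
      ∑ i ∈ s, (c i y • nabla (Z i) y v + mvfderiv 𝓘(ℝ, E) (c i) y v • Z i y) := by
  classical
  induction s using Finset.induction_on with
  | empty =>
    rw [Finset.sum_empty, Finset.sum_empty, CovariantDerivative.zero]
    rfl
  | insert a s ha ih =>
    rw [Finset.sum_insert ha, Finset.sum_insert ha, nabla.isCovariantDerivativeOnUniv.add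
        ((hc a).smul_section (hZ a)) (mdifferentiableAt_sum_smul s hc hZ),
      nabla.isCovariantDerivativeOnUniv.leibniz (hZ a) (hc a), ← ih]
    rfl

/-- In the coordinates of the chart at `x₀` the connection is, at the point `y` of its domain, the
flat one plus the Christoffel symbols `Γ`, which are smooth at that point. -/
structure IsChristoffelAt (x₀ : M) (Γ : E → E →L[ℝ] E →L[ℝ] E) (y : M) : Prop where
  mem_source : y ∈ (chartAt E x₀).source
  contDiffAt : ContDiffAt ℝ ∞ Γ (chartAt E x₀ y)
  inChart_nabla {X : (z : M) → TangentSpace 𝓘(ℝ, E) z} (hX : MDiffAt (T% X) y)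
    (v : TangentSpace 𝓘(ℝ, E) y) :
    mvfderiv 𝓘(ℝ, E) (chartAt E x₀) y (nabla X y v) =
      mvfderiv 𝓘(ℝ, E) (inChart x₀ X) y v +
        Γ (chartAt E x₀ y) (mvfderiv 𝓘(ℝ, E) (chartAt E x₀) y v) (inChart x₀ X y)

variable [FiniteDimensional ℝ E] {ι : Type*} (b : Module.Basis ι ℝ E)

variable (x₀) in
/-- The coordinate frame of the chart at `x₀` associated with a basis of the model space, cut off
by a bump function to obtain vector fields on all of `M`. -/
def coordFrame (i : ι) (z : M) : TangentSpace 𝓘(ℝ, E) z :=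
  bumpAt E x₀ z • (trivializationAt E (TangentSpace 𝓘(ℝ, E) : M → Type _) x₀).localFrame b i z

theorem contMDiff_coordFrame [T2Space M] (i : ι) : CMDiff ∞ (T% (coordFrame x₀ b i)) :=
  ContMDiffOn.smul_section_of_tsupport (bumpAt E x₀).contMDiff.contMDiffOn
    (trivializationAt E (TangentSpace 𝓘(ℝ, E) : M → Type _) x₀).open_baseSet
    (bumpAt E x₀).tsupport_subset_chartAt_source
    ((trivializationAt E (TangentSpace 𝓘(ℝ, E) : M → Type _) x₀).contMDiffOn_localFrame_baseSet
      ∞ b i)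

variable (x₀) in
theorem eventually_inChart_coordFrame :
    ∀ᶠ z in nhds x₀, ∀ i, inChart x₀ (coordFrame x₀ b i) z = b i := by
  let t := trivializationAt E (TangentSpace 𝓘(ℝ, E) : M → Type _) x₀
  filter_upwards [(bumpAt E x₀).eventuallyEq_one,
    (chartAt E x₀).open_source.mem_nhds (mem_chart_source E x₀)] with z hz hzs i
  rw [inChart, coordFrame, hz, Pi.one_apply, one_smul, t.localFrame_apply_of_mem_baseSet b hzs,
    ← trivializationAt_apply_snd hzs]
  exact congrArg Prod.snd (t.apply_mk_symm hzs (b i))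

variable [Fintype ι]

theorem eq_sum_repr_smul_coordFrame (hy : y ∈ (chartAt E x₀).source)
    (hb : ∀ i, inChart x₀ (coordFrame x₀ b i) y = b i) (v : TangentSpace 𝓘(ℝ, E) y) :
    v = ∑ i, b.repr (mvfderiv 𝓘(ℝ, E) (chartAt E x₀) y v) i • coordFrame x₀ b i y := by
  apply (chartEquiv (IsManifold.chart_mem_maximalAtlas x₀) hy).injective
  simp only [map_sum, map_smul, chartEquiv_apply]
  exact (b.sum_repr _).symm.trans
    (Finset.sum_congr rfl fun i _ ↦ congrArg _ (hb i).symm)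

variable (x₀) in
/-- The Christoffel symbols in the chart at `x₀`: the bilinear maps that send `(b j, b i)` to the
coordinates of the derivative of the `i`-th along the `j`-th vector field of the coordinate
frame. -/
def christoffel (p : E) : E →L[ℝ] E →L[ℝ] E :=
  ∑ i, ∑ j, (b.coord j).toContinuousLinearMap.smulRight
    ((b.coord i).toContinuousLinearMap.smulRight
      (inChart x₀ (fun z ↦ nabla (coordFrame x₀ b i) z (coordFrame x₀ b j z))
        ((chartAt E x₀).symm p)))

theorem christoffel_apply (hy : y ∈ (chartAt E x₀).source)
    (hb : ∀ i, inChart x₀ (coordFrame x₀ b i) y = b i) (v : TangentSpace 𝓘(ℝ, E) y) (w : E) :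
    christoffel x₀ nabla b (chartAt E x₀ y) (mvfderiv 𝓘(ℝ, E) (chartAt E x₀) y v) w =
      ∑ i, b.repr w i •
        mvfderiv 𝓘(ℝ, E) (chartAt E x₀) y (nabla (coordFrame x₀ b i) y v) := by
  conv_rhs => rw [eq_sum_repr_smul_coordFrame b hy hb v]
  simp only [christoffel, _root_.sum_apply, ContinuousLinearMap.smulRight_apply,
    _root_.smul_apply, (chartAt E x₀).left_inv hy, map_sum, map_smul, Finset.smul_sum]
  exact Finset.sum_congr rfl fun i _ ↦ Finset.sum_congr rfl fun j _ ↦ smul_comm _ _ _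

variable {nabla} [T2Space M]

theorem contDiffAt_christoffel
    (hsmooth : CovariantDerivative.ContMDiffCovariantDerivative nabla ∞)
    (hy : y ∈ (chartAt E x₀).source) :
    ContDiffAt ℝ ∞ (christoffel x₀ nabla b) (chartAt E x₀ y) := by
  refine ContDiffAt.sum fun i _ ↦ ContDiffAt.sum fun j _ ↦
    contDiffAt_const.smulRight (contDiffAt_const.smulRight ?_)
  exact contDiffAt_comp_chart_symm (IsManifold.chart_mem_maximalAtlas x₀) hy <|
    contMDiffAt_inChart hy <|
      contMDiff_nabla_apply hsmooth (contMDiff_coordFrame b i) (contMDiff_coordFrame b j) y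

theorem nabla_eq_sum_coordFrame (hy : y ∈ (chartAt E x₀).source)
    (hb : ∀ᶠ z in nhds y, ∀ i, inChart x₀ (coordFrame x₀ b i) z = b i)
    {X : (z : M) → TangentSpace 𝓘(ℝ, E) z} (hX : MDiffAt (T% X) y) (v : TangentSpace 𝓘(ℝ, E) y) :
    nabla X y v = ∑ i, (b.repr (inChart x₀ X y) i • nabla (coordFrame x₀ b i) y v +
      b.repr (mvfderiv 𝓘(ℝ, E) (inChart x₀ X) y v) i • coordFrame x₀ b i y) := by
  let β (i : ι) : E →L[ℝ] ℝ := (b.coord i).toContinuousLinearMap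
  have hXs := mdifferentiableAt_inChart hy hX
  have hc (i : ι) : MDiffAt (β i ∘ inChart x₀ X) y :=
    (β i).differentiableAt.mdifferentiableAt.comp y hXs
  have hZ (i : ι) : MDiffAt (T% (coordFrame x₀ b i)) y :=
    (contMDiff_coordFrame b i y).mdifferentiableAt (by simp)
  have hdc (i : ι) : mvfderiv 𝓘(ℝ, E) (β i ∘ inChart x₀ X) y v =
      b.repr (mvfderiv 𝓘(ℝ, E) (inChart x₀ X) y v) i := by
    have hcomp := mfderiv_comp_apply y (β i).differentiableAt.mdifferentiableAt hXs v
    rwa [mfderiv_eq_fderiv, (β i).fderiv] at hcomp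
  have hexp : ∀ᶠ z in nhds y, X z =
      (∑ i, (β i ∘ inChart x₀ X) • coordFrame x₀ b i : (z : M) → TangentSpace 𝓘(ℝ, E) z) z := by
    filter_upwards [(chartAt E x₀).open_source.mem_nhds hy, hb] with z hz hbz
    rw [Finset.sum_apply]
    exact eq_sum_repr_smul_coordFrame b hz hbz (X z)
  rw [nabla.isCovariantDerivativeOnUniv.congr_of_eventuallyEq hX
    (mdifferentiableAt_sum_smul _ hc hZ) Filter.univ_mem hexp, nabla_sum_smul nabla _ hc hZ]
  simp only [hdc]
  rfl

variable (x₀) in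
theorem eventually_isChristoffelAt
    (hsmooth : CovariantDerivative.ContMDiffCovariantDerivative nabla ∞) :
    ∀ᶠ y in nhds x₀, IsChristoffelAt nabla x₀ (christoffel x₀ nabla b) y := by
  filter_upwards [(chartAt E x₀).open_source.mem_nhds (mem_chart_source E x₀),
    (eventually_inChart_coordFrame x₀ b).eventually_nhds] with y hy hb
  refine ⟨hy, contDiffAt_christoffel b hsmooth hy, fun hX v ↦ ?_⟩
  have hbasis (i : ι) : mvfderiv 𝓘(ℝ, E) (chartAt E x₀) y (coordFrame x₀ b i y) = b i :=
    hb.self_of_nhds i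
  rw [nabla_eq_sum_coordFrame b hy hb hX v, christoffel_apply nabla b hy hb.self_of_nhds]
  simp only [map_sum, map_add, map_smul, hbasis, Finset.sum_add_distrib, b.sum_repr]
  exact add_comm _ _

end Connection

/-! ### Iterated covariant differentials in coordinates -/

section LocalCovDiff

variable {E : Type*} [NormedAddCommGroup E] [NormedSpace ℝ E]

variable (E) in
/-- The action of the endomorphisms of `E` on multilinear maps by derivations. -/
def slotAction (r : ℕ) : (E →L[ℝ] E) →L[ℝ] (E [×r]→L[ℝ] ℂ) →L[ℝ] (E [×r]→L[ℝ] ℂ) :=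
  (ContinuousMultilinearMap.compContinuousLinearMapContinuousMultilinear ℝ
    (fun _ : Fin r ↦ E) (fun _ ↦ E) ℂ).linearDeriv (fun _ ↦ ContinuousLinearMap.id ℝ E) ∘L
    ContinuousLinearMap.pi fun _ ↦ ContinuousLinearMap.id ℝ (E →L[ℝ] E)

theorem slotAction_apply {r : ℕ} (B : E →L[ℝ] E) (τ : E [×r]→L[ℝ] ℂ) (v : Fin r → E) :
    slotAction E r B τ v = ∑ k, τ (Function.update v k (B (v k))) := by
  rw [slotAction, ContinuousLinearMap.comp_apply, ContinuousMultilinearMap.linearDeriv_apply,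
    _root_.sum_apply, _root_.sum_apply]
  refine Finset.sum_congr rfl fun k _ ↦ congrArg τ (funext fun j ↦ ?_)
  rcases eq_or_ne j k with rfl | hjk
  · simp
  · simp [hjk]

variable (E) in
/-- Uncurrying of multilinear maps, as a continuous linear map. -/
def uncurryLeftCLM (r : ℕ) : (E →L[ℝ] E [×r]→L[ℝ] ℂ) →L[ℝ] (E [×(r + 1)]→L[ℝ] ℂ) :=
  (continuousMultilinearCurryLeftEquiv ℝ
    (fun _ : Fin (r + 1) ↦ E) ℂ).symm.toContinuousLinearEquiv.toContinuousLinearMap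

/-- The iterated covariant differential of a function on the model space, for the connection with
the Christoffel symbols `Γ`. -/
def localCovDiff (Γ : E → E →L[ℝ] E →L[ℝ] E) (F : E → ℂ) : (r : ℕ) → E → E [×r]→L[ℝ] ℂ
  | 0 => (continuousMultilinearCurryFin0 ℝ E ℂ).symm ∘ F
  | r + 1 => fun p ↦ uncurryLeftCLM E r
      (fderiv ℝ (localCovDiff Γ F r) p - (slotAction E r).flip (localCovDiff Γ F r p) ∘L Γ p)

variable {Γ : E → E →L[ℝ] E →L[ℝ] E} {F G : E → ℂ} {p : E}

theorem localCovDiff_succ_apply (Γ : E → E →L[ℝ] E →L[ℝ] E) (F : E → ℂ) (r : ℕ) (p : E)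
    (v : Fin (r + 1) → E) :
    localCovDiff Γ F (r + 1) p v = fderiv ℝ (localCovDiff Γ F r) p (v 0) (Fin.tail v) -
      ∑ k, localCovDiff Γ F r p (Function.update (Fin.tail v) k (Γ p (v 0) (v k.succ))) := by
  change (fderiv ℝ (localCovDiff Γ F r) p -
    (slotAction E r).flip (localCovDiff Γ F r p) ∘L Γ p) (v 0) (Fin.tail v) = _
  rw [_root_.sub_apply, _root_.sub_apply, ContinuousLinearMap.comp_apply,
    ContinuousLinearMap.flip_apply, slotAction_apply]
  rfl

theorem vanishesToOrder_localCovDiff (hΓ : ContDiffAt ℝ ∞ Γ p) (r : ℕ) {l : ℕ}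
    (hF : VanishesToOrder ℝ (r + l) F p) : VanishesToOrder ℝ l (localCovDiff Γ F r) p := by
  induction r generalizing l with
  | zero =>
    rw [zero_add] at hF
    exact hF.clm_comp
      (continuousMultilinearCurryFin0 ℝ E ℂ).symm.toContinuousLinearEquiv.toContinuousLinearMap
  | succ r ih =>
    have hr : VanishesToOrder ℝ (l + 1) (localCovDiff Γ F r) p :=
      ih (by rwa [add_right_comm] at hF)
    have hΓr := hr.flip_comp (slotAction E r) (.of_contDiffAt hΓ)
    exact (hr.fderiv.sub (hΓr.mono (Nat.le_succ l))).clm_comp (uncurryLeftCLM E r)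

theorem contDiffAt_localCovDiff (hΓ : ContDiffAt ℝ ∞ Γ p) (hF : ContDiffAt ℝ ∞ F p) (r : ℕ) :
    ContDiffAt ℝ ∞ (localCovDiff Γ F r) p := by
  induction r with
  | zero => exact (continuousMultilinearCurryFin0 ℝ E ℂ).symm.contDiff.contDiffAt.comp p hF
  | succ r ih =>
    exact (uncurryLeftCLM E r).contDiff.contDiffAt.comp p ((ih.fderiv_right (by simp)).sub
      ((VanishesToOrder.of_contDiffAt ih).flip_comp (slotAction E r) (.of_contDiffAt hΓ)).1)

theorem localCovDiff_add_smul (hΓ : ∀ᶠ q in nhds p, ContDiffAt ℝ ∞ Γ q)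
    (hF : ∀ᶠ q in nhds p, ContDiffAt ℝ ∞ F q) (hG : ∀ᶠ q in nhds p, ContDiffAt ℝ ∞ G q)
    (c : ℂ) (r : ℕ) :
    localCovDiff Γ (F + c • G) r =ᶠ[nhds p] localCovDiff Γ F r + c • localCovDiff Γ G r := by
  induction r with
  | zero => exact .rfl
  | succ r ih =>
    filter_upwards [ih.eventually_nhds, hΓ, hF, hG] with q hq hΓq hFq hGq
    have hdF : DifferentiableAt ℝ (localCovDiff Γ F r) q :=
      (contDiffAt_localCovDiff hΓq hFq r).differentiableAt (by simp)
    have hdG : DifferentiableAt ℝ (localCovDiff Γ G r) q :=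
      (contDiffAt_localCovDiff hΓq hGq r).differentiableAt (by simp)
    ext v
    rw [Pi.add_apply, Pi.smul_apply, _root_.add_apply, _root_.smul_apply]
    simp only [localCovDiff_succ_apply]
    rw [Filter.EventuallyEq.fderiv_eq hq, fderiv_add hdF (hdG.const_smul c),
      fderiv_const_smul hdG c, hq.self_of_nhds]
    simp only [Pi.add_apply, Pi.smul_apply, _root_.add_apply, _root_.smul_apply,
      Finset.sum_add_distrib, smul_eq_mul, ← Finset.mul_sum]
    ring

theorem vanishesToOrder_localCovDiff_sub (hΓ : ContDiffAt ℝ ∞ Γ p) (r : ℕ) {l : ℕ}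
    (hF : VanishesToOrder ℝ (r + l) F p) :
    VanishesToOrder ℝ (l + 1) (localCovDiff Γ F r - iteratedFDeriv ℝ r F) p := by
  induction r generalizing l with
  | zero =>
    rw [iteratedFDeriv_zero_eq_comp, localCovDiff, sub_self]
    exact .zero
  | succ r ih =>
    rw [add_right_comm] at hF
    have hdF : ∀ᶠ q in nhds p, DifferentiableAt ℝ (localCovDiff Γ F r) q :=
      (((contDiffAt_localCovDiff hΓ hF.1 r).of_le (m := 1) (by simp)).eventually (by simp)).mono
        fun q hq ↦ hq.differentiableAt (by simp)
    have hdF' : ∀ᶠ q in nhds p, DifferentiableAt ℝ (iteratedFDeriv ℝ r F) q :=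
      ((hF.1.of_le (m := (r + 1 : ℕ)) (mod_cast le_top)).eventually (by simp)).mono fun q hq ↦
        hq.differentiableAt_iteratedFDeriv (mod_cast Nat.lt_succ_self r)
    refine (((ih hF).fderiv.sub ((vanishesToOrder_localCovDiff hΓ r hF).flip_comp (slotAction E r)
      (.of_contDiffAt hΓ))).clm_comp (uncurryLeftCLM E r)).congr ?_
    filter_upwards [hdF, hdF'] with q hq hq'
    rw [Function.comp_apply, Pi.sub_apply, Pi.sub_apply, fderiv_sub hq hq',
      iteratedFDeriv_succ_eq_comp_left]
    exact (congrArg (uncurryLeftCLM E r) (sub_right_comm _ _ _)).trans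
      (map_sub (uncurryLeftCLM E r) _ _)

end LocalCovDiff

section CovDiff

open scoped Bundle

variable {E : Type*} [NormedAddCommGroup E] [NormedSpace ℝ E]
  {M : Type*} [TopologicalSpace M] [ChartedSpace E M] [IsManifold 𝓘(ℝ, E) ∞ M]
  {nabla : CovariantDerivative 𝓘(ℝ, E) E (TangentSpace 𝓘(ℝ, E) : M → Type _)}
  {x₀ y : M} {Γ : E → E →L[ℝ] E →L[ℝ] E} {r : ℕ}

theorem mvfderiv_coTensor_apply {T : (x : M) → CoTensor E r x} {τ : E → E [×r]→L[ℝ] ℂ}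
    (hy : y ∈ (chartAt E x₀).source) (hτ : DifferentiableAt ℝ τ (chartAt E x₀ y))
    (hT : ∀ᶠ z in nhds y, ∀ v, T z v =
      τ (chartAt E x₀ z) fun k ↦ mvfderiv 𝓘(ℝ, E) (chartAt E x₀) z (v k))
    {X : Fin r → (z : M) → TangentSpace 𝓘(ℝ, E) z} (hX : ∀ k, MDiffAt (T% (X k)) y)
    (v : TangentSpace 𝓘(ℝ, E) y) :
    mvfderiv 𝓘(ℝ, E) (fun z ↦ T z fun k ↦ X k z) y v =
      fderiv ℝ τ (chartAt E x₀ y) (mvfderiv 𝓘(ℝ, E) (chartAt E x₀) y v)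
          (fun k ↦ inChart x₀ (X k) y) +
        ∑ k, τ (chartAt E x₀ y) (Function.update (fun j ↦ inChart x₀ (X j) y) k
          (mvfderiv 𝓘(ℝ, E) (inChart x₀ (X k)) y v)) := by
  set e := chartAt E x₀
  have he : e ∈ IsManifold.maximalAtlas 𝓘(ℝ, E) ∞ M := IsManifold.chart_mem_maximalAtlas x₀
  have hXd (k : Fin r) := mdifferentiableAt_inChart hy (hX k)
  have hchart : (fun z ↦ T z fun k ↦ X k z) =ᶠ[nhds y]
      (fun q ↦ τ q fun k ↦ (inChart x₀ (X k) ∘ e.symm) q) ∘ e := by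
    filter_upwards [hT, e.open_source.mem_nhds hy] with z hz hzs
    simp only [hz, Function.comp_apply, e.left_inv hzs]
    rfl
  have hder := hτ.hasFDerivAt.continuousMultilinearMap_apply fun k ↦
    (differentiableAt_comp_chart_symm he hy (hXd k)).hasFDerivAt
  rw [mvfderiv_congr hchart, mvfderiv_comp_chart he hy hder.differentiableAt, hder.fderiv]
  simp only [Function.comp_apply, e.left_inv hy, _root_.add_apply, _root_.sum_apply,
    ContinuousLinearMap.comp_apply]
  refine congrArg _ (Finset.sum_congr rfl fun k _ ↦ ?_)
  rw [mvfderiv_eq_fderiv_chart he hy (hXd k)]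
  rfl

theorem IsChristoffelAt.covDiff_eq (hΓ : IsChristoffelAt nabla x₀ Γ y)
    {T : (x : M) → CoTensor E r x} {τ : E → E [×r]→L[ℝ] ℂ}
    (hτ : DifferentiableAt ℝ τ (chartAt E x₀ y))
    (hT : ∀ᶠ z in nhds y, ∀ v, T z v =
      τ (chartAt E x₀ z) fun k ↦ mvfderiv 𝓘(ℝ, E) (chartAt E x₀) z (v k))
    (v : Fin (r + 1) → TangentSpace 𝓘(ℝ, E) y) {w : Fin (r + 1) → E}
    (hw : ∀ k, mvfderiv 𝓘(ℝ, E) (chartAt E x₀) y (v k) = w k) :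
    covDiff nabla T y v = fderiv ℝ τ (chartAt E x₀ y) (w 0) (Fin.tail w) -
      ∑ k, τ (chartAt E x₀ y)
        (Function.update (Fin.tail w) k (Γ (chartAt E x₀ y) (w 0) (w k.succ))) := by
  let X (k : Fin r) : (z : M) → TangentSpace 𝓘(ℝ, E) z := FiberBundle.extend E (v k.succ)
  have hX (k : Fin r) : MDiffAt (T% (X k)) y :=
    FiberBundle.mdifferentiableAt_extend 𝓘(ℝ, E) E (v k.succ)
  have hXw (k : Fin r) : inChart x₀ (X k) y = w k.succ := by
    rw [inChart, ← hw, show X k y = v k.succ from FiberBundle.extend_apply_self E (v k.succ)]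
  have hcorrection (k : Fin r) :
      T y (Function.update (fun j ↦ v j.succ) k (nabla (X k) y (v 0))) =
        τ (chartAt E x₀ y)
          (Function.update (Fin.tail w) k (Γ (chartAt E x₀ y) (w 0) (w k.succ))) +
        τ (chartAt E x₀ y) (Function.update (Fin.tail w) k
          (mvfderiv 𝓘(ℝ, E) (inChart x₀ (X k)) y (v 0))) := by
    rw [hT.self_of_nhds, ← ContinuousMultilinearMap.map_update_add]
    refine congrArg _ (funext fun j ↦ ?_)
    rcases eq_or_ne j k with rfl | hjk
    · rw [Function.update_self, Function.update_self, hΓ.inChart_nabla (hX j), hXw, hw,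
        add_comm (Γ _ _ _)]
    · rw [Function.update_of_ne hjk, Function.update_of_ne hjk, hw, Fin.tail]
  change mvfderiv 𝓘(ℝ, E) (fun z ↦ T z fun k ↦ X k z) y (v 0) -
    ∑ k, T y (Function.update (fun j ↦ v j.succ) k (nabla (X k) y (v 0))) = _
  rw [mvfderiv_coTensor_apply hΓ.mem_source hτ hT hX, Finset.sum_congr rfl fun k _ ↦ hcorrection k,
    Finset.sum_add_distrib]
  simp only [hXw, hw]
  exact add_sub_add_right_eq_sub (G := ℂ) _ _ _

theorem iterCovDiff_eq_localCovDiff (hΓ : ∀ᶠ y in nhds x₀, IsChristoffelAt nabla x₀ Γ y)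
    (f : SmoothFun E M) (r : ℕ) : ∀ᶠ y in nhds x₀, ∀ v, iterCovDiff nabla f r y v =
      localCovDiff Γ ((f : M → ℂ) ∘ (chartAt E x₀).symm) r (chartAt E x₀ y)
        fun k ↦ mvfderiv 𝓘(ℝ, E) (chartAt E x₀) y (v k) := by
  induction r with
  | zero =>
    filter_upwards [hΓ] with y hy
    exact fun _ ↦ congrArg (f : M → ℂ) ((chartAt E x₀).left_inv hy.mem_source).symm
  | succ r ih =>
    filter_upwards [hΓ, ih.eventually_nhds] with y hy ih v
    have hF := contDiffAt_coe_comp_symm (IsManifold.chart_mem_maximalAtlas x₀) hy.mem_source f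
    rw [localCovDiff_succ_apply]
    exact hy.covDiff_eq ((contDiffAt_localCovDiff hy.contDiffAt hF r).differentiableAt (by simp))
      ih v fun _ ↦ rfl

end CovDiff

/-! ### Quantization of homogeneous tensor fields -/

theorem contMDiffAt_mul {𝕜 E H M A : Type*} [NontriviallyNormedField 𝕜] [NormedAddCommGroup E]
    [NormedSpace 𝕜 E] [TopologicalSpace H] {I : ModelWithCorners 𝕜 E H} [TopologicalSpace M]
    [ChartedSpace H M] [NormedRing A] [NormedAlgebra 𝕜 A] {n : WithTop ℕ∞} {f g : M → A} {x : M}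
    (hf : ContMDiffAt I 𝓘(𝕜, A) n f x) (hg : ContMDiffAt I 𝓘(𝕜, A) n g x) :
    ContMDiffAt I 𝓘(𝕜, A) n (fun y ↦ f y * g y) x :=
  contDiff_mul.contMDiff.contMDiffAt.comp x (hf.prodMk_space hg)

section QuantizedHom

variable {E : Type*} [NormedAddCommGroup E] [NormedSpace ℝ E]
  {M : Type*} [TopologicalSpace M] [ChartedSpace E M] [IsManifold 𝓘(ℝ, E) ∞ M]
  {nabla : CovariantDerivative 𝓘(ℝ, E) E (TangentSpace 𝓘(ℝ, E) : M → Type _)}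
  {x₀ : M} {Γ : E → E →L[ℝ] E →L[ℝ] E} {r : ℕ}

theorem iterCovDiff_add_smul (hΓ : ∀ᶠ y in nhds x₀, IsChristoffelAt nabla x₀ Γ y)
    (f g : SmoothFun E M) (c : ℂ) :
    iterCovDiff nabla ((f + c • g : SmoothFun E M) : M → ℂ) r x₀ =
      iterCovDiff nabla f r x₀ + c • iterCovDiff nabla g r x₀ := by
  set e := chartAt E x₀
  have hx : x₀ ∈ e.source := mem_chart_source E x₀
  have hsmooth : ∀ᶠ p in nhds (e x₀), ContDiffAt ℝ ∞ Γ p ∧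
      ∀ f : SmoothFun E M, ContDiffAt ℝ ∞ ((f : M → ℂ) ∘ e.symm) p := by
    filter_upwards [e.open_target.mem_nhds (e.map_source hx), e.tendsto_symm hx hΓ] with p hp hΓp
    have he := IsManifold.chart_mem_maximalAtlas (I := 𝓘(ℝ, E)) (n := ∞) x₀
    rw [← e.right_inv hp]
    exact ⟨hΓp.contDiffAt, contDiffAt_coe_comp_symm he hΓp.mem_source⟩
  have hlocal := localCovDiff_add_smul (hsmooth.mono fun _ h ↦ h.1)
    (hsmooth.mono fun _ h ↦ h.2 f) (hsmooth.mono fun _ h ↦ h.2 g) c r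
  ext v
  simp only [Pi.add_apply, Pi.smul_apply, (iterCovDiff_eq_localCovDiff hΓ _ r).self_of_nhds v]
  exact congrArg (fun m ↦ m fun k ↦ mvfderiv 𝓘(ℝ, E) e x₀ (v k)) hlocal.self_of_nhds

theorem iterCovDiff_eq_zero (hΓ : ∀ᶠ y in nhds x₀, IsChristoffelAt nabla x₀ Γ y)
    {f : SmoothFun E M} (hf : f ∈ idealAt E x₀ ^ (r + 1)) : iterCovDiff nabla f r x₀ = 0 := by
  have hF := vanishesToOrder_of_mem_idealAt_pow (IsManifold.chart_mem_maximalAtlas x₀)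
    (mem_chart_source E x₀) hf
  ext v
  rw [(iterCovDiff_eq_localCovDiff hΓ f r).self_of_nhds v,
    (vanishesToOrder_localCovDiff hΓ.self_of_nhds.contDiffAt r hF).eq_zero]
  rfl

theorem iterCovDiff_eq_chartDiff (hΓ : ∀ᶠ y in nhds x₀, IsChristoffelAt nabla x₀ Γ y)
    {f : SmoothFun E M} (hf : f ∈ idealAt E x₀ ^ r) :
    iterCovDiff nabla f r x₀ = chartDiff (chartAt E x₀) r f x₀ := by
  have hF := vanishesToOrder_of_mem_idealAt_pow (IsManifold.chart_mem_maximalAtlas x₀)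
    (mem_chart_source E x₀) hf
  have hlocal := vanishesToOrder_localCovDiff_sub (l := 0) hΓ.self_of_nhds.contDiffAt r hF
  ext v
  rw [(iterCovDiff_eq_localCovDiff hΓ f r).self_of_nhds v, chartDiff, sub_eq_zero.1 hlocal.eq_zero]

variable [FiniteDimensional ℝ E]

theorem quantized_eq (nabla : CovariantDerivative 𝓘(ℝ, E) E (TangentSpace 𝓘(ℝ, E) : M → Type _))
    (hbar : ℝ) (Φ : SymTensorField E M r) (f : SmoothFun E M) (x : M) :
    quantized nabla hbar Φ f x =
      (-Complex.I * hbar) ^ r * contract (Φ.1 x) (iterCovDiff nabla f r x) := by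
  rw [quantized, contract_symmetrize (Φ.2.1 x)]

theorem eventually_quantized_eq_sum {ι : Type*} [Fintype ι] (b : Module.Basis ι ℝ E)
    (hΓ : ∀ᶠ y in nhds x₀, IsChristoffelAt nabla x₀ Γ y) (hbar : ℝ) (Φ : SymTensorField E M r)
    (f : SmoothFun E M) : ∀ᶠ y in nhds x₀, quantized nabla hbar Φ f y =
      (-Complex.I * hbar) ^ r * ∑ i : Fin r → ι,
        Φ.1 y (fun k ↦ (b.coord (i k)).comp (mvfderiv 𝓘(ℝ, E) (chartAt E x₀) y).toLinearMap) *
        localCovDiff Γ ((f : M → ℂ) ∘ (chartAt E x₀).symm) r (chartAt E x₀ y)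
          fun k ↦ b (i k) := by
  filter_upwards [hΓ, iterCovDiff_eq_localCovDiff hΓ f r] with y hy hlocal
  let A := chartEquiv (IsManifold.chart_mem_maximalAtlas (I := 𝓘(ℝ, E)) (n := ∞) x₀) hy.mem_source
  let η : MultilinearMap ℝ (fun _ : Fin r ↦ TangentSpace 𝓘(ℝ, E) y) ℂ :=
    (localCovDiff Γ ((f : M → ℂ) ∘ (chartAt E x₀).symm) r
      (chartAt E x₀ y)).toMultilinearMap.compLinearMap fun _ ↦ A.toLinearMap
  have hη (w : Fin r → E) : η (fun k ↦ A.symm (w k)) =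
      localCovDiff Γ ((f : M → ℂ) ∘ (chartAt E x₀).symm) r (chartAt E x₀ y) w :=
    congrArg _ (funext fun k ↦ A.apply_symm_apply (w k))
  rw [quantized_eq, show iterCovDiff nabla f r y = fun v ↦ η v from funext hlocal,
    contract_eq_sum_basis _ η (b.map A.symm)]
  simp only [Module.Basis.map_apply, hη]
  rfl

theorem contMDiffAt_quantized (hΓ : ∀ᶠ y in nhds x₀, IsChristoffelAt nabla x₀ Γ y) (hbar : ℝ)
    (Φ : SymTensorField E M r) (f : SmoothFun E M) :
    ContMDiffAt 𝓘(ℝ, E) 𝓘(ℝ, ℂ) ∞ (quantized nabla hbar Φ f) x₀ := by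
  have he := IsManifold.chart_mem_maximalAtlas (I := 𝓘(ℝ, E)) (n := ∞) x₀
  have hx := mem_chart_source E x₀
  let b := Module.finBasis ℝ E
  refine ContMDiffAt.congr_of_eventuallyEq (contMDiffAt_mul contMDiffAt_const
    (ContMDiffAt.sum fun i _ ↦ contMDiffAt_mul ?_ ?_)) (eventually_quantized_eq_sum b hΓ hbar Φ f)
  · exact (Φ.2.2 _ he _).contMDiffAt ((chartAt E x₀).open_source.mem_nhds hx)
  · have hlocal := contDiffAt_localCovDiff hΓ.self_of_nhds.contDiffAt
      (contDiffAt_coe_comp_symm he hx f) r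
    exact contMDiffAt_comp_chart he hx <| (ContinuousMultilinearMap.apply ℝ (fun _ : Fin r ↦ E) ℂ
      fun k ↦ b (i k)).contDiff.contDiffAt.comp _ hlocal

variable [T2Space M]

/-- The quantization rule on the homogeneous tensor fields of order `r`. -/
def quantizedHom (hsmooth : CovariantDerivative.ContMDiffCovariantDerivative nabla ∞) (hbar : ℝ)
    (r : ℕ) : SymTensorField E M r →ₗ[ℂ] SmoothFun E M →ₗ[ℂ] SmoothFun E M :=
  have hΓ (x : M) := eventually_isChristoffelAt x (Module.finBasis ℝ E) hsmooth
  LinearMap.mk₂ ℂ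
    (fun Φ f ↦ ⟨quantized nabla hbar Φ f, fun x ↦ contMDiffAt_quantized (hΓ x) hbar Φ f⟩)
    (fun Φ Ψ f ↦ Subtype.ext <| funext fun x ↦ by
      change quantized nabla hbar (Φ + Ψ) f x =
        quantized nabla hbar Φ f x + quantized nabla hbar Ψ f x
      simp only [quantized_eq, ← contractₗ_apply, ← mul_add, ← LinearMap.add_apply, ← map_add]
      rfl)
    (fun c Φ f ↦ Subtype.ext <| funext fun x ↦ by
      change quantized nabla hbar (c • Φ) f x = c * quantized nabla hbar Φ f x
      simp only [quantized_eq, mul_left_comm c]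
      exact congrArg _ (LinearMap.map_smul₂ contractₗ c (Φ.1 x) (iterCovDiff nabla f r x)))
    (fun Φ f g ↦ Subtype.ext <| funext fun x ↦ by
      have hadd := iterCovDiff_add_smul (r := r) (hΓ x) f g 1
      rw [one_smul, one_smul] at hadd
      change quantized nabla hbar Φ (f + g) x =
        quantized nabla hbar Φ f x + quantized nabla hbar Φ g x
      simp only [quantized_eq, hadd, ← contractₗ_apply, map_add, mul_add])
    (fun c Φ f ↦ Subtype.ext <| funext fun x ↦ by
      have hsmul := iterCovDiff_add_smul (r := r) (hΓ x) 0 f c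
      rw [zero_add, iterCovDiff_eq_zero (hΓ x) (Ideal.zero_mem _), zero_add] at hsmul
      change quantized nabla hbar Φ (c • f) x = c * quantized nabla hbar Φ f x
      simp only [quantized_eq, hsmul, ← contractₗ_apply, map_smul, smul_eq_mul, mul_left_comm c])

variable (hsmooth : CovariantDerivative.ContMDiffCovariantDerivative nabla ∞) (hbar : ℝ)

theorem quantizedHom_apply (Φ : SymTensorField E M r) (f : SmoothFun E M) :
    (quantizedHom hsmooth hbar r Φ f : M → ℂ) = quantized nabla hbar Φ f :=
  rfl

theorem hasOrder_quantizedHom (Φ : SymTensorField E M r) :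
    HasOrder r (quantizedHom hsmooth hbar r Φ) := by
  intro x f hf
  have hΓ := eventually_isChristoffelAt x (Module.finBasis ℝ E) hsmooth
  rw [mem_idealAt, quantizedHom_apply, quantized_eq, iterCovDiff_eq_zero hΓ hf, ← contractₗ_apply,
    map_zero, mul_zero]

theorem isSymbol_quantizedHom (Φ : SymTensorField E M r) :
    IsSymbol r (quantizedHom hsmooth hbar r Φ) ((-Complex.I * hbar) ^ r • Φ) := by
  refine isSymbol_of_prod (hasOrder_quantizedHom hsmooth hbar Φ) fun x f hf ↦ ?_
  have hΓ := eventually_isChristoffelAt x (Module.finBasis ℝ E) hsmooth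
  rw [quantizedHom_apply, quantized_eq, iterCovDiff_eq_chartDiff hΓ (prod_mem_idealAt_pow hf),
    contract_chartDiff_prod (IsManifold.chart_mem_maximalAtlas x) (mem_chart_source E x) Φ hf]
  change _ = _ * contract ((-Complex.I * hbar) ^ r • Φ.1 x) _
  rw [← contractₗ_apply (_ • _), map_smul, LinearMap.smul_apply, contractₗ_apply, smul_eq_mul,
    mul_left_comm]

end QuantizedHom

/-! ### Operators with vanishing symbol -/

section SymbolArithmetic

variable {E : Type*} [NormedAddCommGroup E] [NormedSpace ℝ E] [FiniteDimensional ℝ E]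
  {M : Type*} [TopologicalSpace M] [ChartedSpace E M]
  {r : ℕ} {P Q : SmoothFun E M →ₗ[ℂ] SmoothFun E M} {σ τ : SymTensorField E M r}

theorem IsSymbol.add (hP : IsSymbol r P σ) (hQ : IsSymbol r Q τ) : IsSymbol r (P + Q) (σ + τ) := by
  refine ⟨fun x f hf ↦ (idealAt E x).add_mem (hP.1 x f hf) (hQ.1 x f hf),
    fun x f hf e he hx ↦ ?_⟩
  change (P f : M → ℂ) x + (Q f : M → ℂ) x = contractₗ (σ.1 x + τ.1 x) _
  rw [map_add, LinearMap.add_apply, contractₗ_apply, contractₗ_apply, hP.2 x f hf e he hx,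
    hQ.2 x f hf e he hx]

theorem IsSymbol.sub (hP : IsSymbol r P σ) (hQ : IsSymbol r Q τ) : IsSymbol r (P - Q) (σ - τ) := by
  refine ⟨fun x f hf ↦ (idealAt E x).sub_mem (hP.1 x f hf) (hQ.1 x f hf),
    fun x f hf e he hx ↦ ?_⟩
  change (P f : M → ℂ) x - (Q f : M → ℂ) x = contractₗ (σ.1 x - τ.1 x) _
  rw [map_sub, LinearMap.sub_apply, contractₗ_apply, contractₗ_apply, hP.2 x f hf e he hx,
    hQ.2 x f hf e he hx]

theorem isSymbol_zero_iff : IsSymbol r P 0 ↔ HasOrder r P ∧ ∀ x : M, ∀ f ∈ idealAt E x ^ r,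
    ∀ e ∈ IsManifold.maximalAtlas 𝓘(ℝ, E) ∞ M, x ∈ e.source → P f ∈ idealAt E x := by
  have hzero (x : M) (η : CoTensor E r x) : contract (0 : ContraTensor E r x) η = 0 := by
    rw [← contractₗ_apply, map_zero, LinearMap.zero_apply]
  simp only [IsSymbol, mem_idealAt, ZeroMemClass.coe_zero, Pi.zero_apply, hzero]

theorem isSymbol_zero : IsSymbol r (0 : SmoothFun E M →ₗ[ℂ] SmoothFun E M) 0 :=
  isSymbol_zero_iff.2 ⟨fun x _ _ ↦ (idealAt E x).zero_mem,
    fun x _ _ _ _ _ ↦ (idealAt E x).zero_mem⟩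

theorem HasOrder.isSymbol_succ_zero (hP : HasOrder r P) : IsSymbol (r + 1) P 0 :=
  isSymbol_zero_iff.2 ⟨hP.mono r.le_succ, fun x f hf _ _ _ ↦ hP x f hf⟩

variable [IsManifold 𝓘(ℝ, E) ∞ M]

theorem IsSymbol.hasOrder (hP : IsSymbol (r + 1) P 0) : HasOrder r P := fun x f hf ↦
  (isSymbol_zero_iff.1 hP).2 x f hf _ (IsManifold.chart_mem_maximalAtlas x) (mem_chart_source E x)

theorem IsSymbol.eq_zero (hP : IsSymbol 0 P 0) : P = 0 := by
  ext f x
  exact mem_idealAt.1 <| (isSymbol_zero_iff.1 hP).2 x f (by simp) _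
    (IsManifold.chart_mem_maximalAtlas x) (mem_chart_source E x)

end SymbolArithmetic

/-! ### Quantization of inhomogeneous tensor fields -/

section Quantization

variable {E : Type*} [NormedAddCommGroup E] [NormedSpace ℝ E]
  {M : Type*} [TopologicalSpace M] [ChartedSpace E M]

theorem eq_sum_lof {n : ℕ} {Φ : SymTensors E M} (hΦ : ∀ j, n ≤ j → Φ j = 0) :
    Φ = ∑ j ∈ Finset.range n, DirectSum.lof ℂ ℕ (fun j ↦ SymTensorField E M j) j (Φ j) := by
  classical
  have hsupport : DFinsupp.support Φ ⊆ Finset.range n := fun j hj ↦ Finset.mem_range.2 <|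
    not_le.1 fun hn ↦ DFinsupp.mem_support_iff.1 hj (hΦ j hn)
  conv_lhs => rw [← DirectSum.sum_support_of Φ]
  refine Finset.sum_subset hsupport fun j _ hj ↦ ?_
  rw [DFinsupp.notMem_support_iff.1 hj, map_zero]

theorem exists_forall_ge_eq_zero (Φ : SymTensors E M) : ∃ n, ∀ j, n ≤ j → Φ j = 0 := by
  classical
  obtain ⟨n, hn⟩ := (DFinsupp.support Φ).bddAbove
  exact ⟨n + 1, fun j hj ↦ DFinsupp.notMem_support_iff.1 fun hmem ↦
    Nat.not_succ_le_self n (hj.trans (hn (Finset.mem_coe.2 hmem)))⟩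

theorem sum_range_sub_sum_Ioc {G : Type*} [AddCommGroup G] (f : ℕ → G) {m n : ℕ} (h : m ≤ n) :
    ∑ j ∈ Finset.range (n + 1), f j - ∑ j ∈ Finset.Ioc m n, f j =
      ∑ j ∈ Finset.range (m + 1), f j := by
  rw [← Finset.Ico_add_one_add_one_eq_Ioc, Finset.sum_Ico_eq_sub f (Nat.add_le_add_right h 1),
    sub_sub_cancel]

theorem pow_hbar_ne_zero {hbar : ℝ} (hhbar : hbar ≠ 0) (n : ℕ) : (-Complex.I * hbar) ^ n ≠ 0 :=
  pow_ne_zero _ (mul_ne_zero (neg_ne_zero.2 Complex.I_ne_zero) (Complex.ofReal_ne_zero.2 hhbar))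

variable [FiniteDimensional ℝ E] [IsManifold 𝓘(ℝ, E) ∞ M] [T2Space M]
  {nabla : CovariantDerivative 𝓘(ℝ, E) E (TangentSpace 𝓘(ℝ, E) : M → Type _)}
  (hsmooth : CovariantDerivative.ContMDiffCovariantDerivative nabla ∞) (hbar : ℝ)

/-- The quantization rule `Φ ↦ Φ̂` on the inhomogeneous symmetric tensor fields. -/
def quantization : SymTensors E M →ₗ[ℂ] DiffOp E M :=
  DirectSum.toModule ℂ ℕ _ fun r ↦ (quantizedHom hsmooth hbar r).codRestrict (DiffOp E M)
    fun Φ ↦ ⟨r, hasOrder_quantizedHom hsmooth hbar Φ⟩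

theorem quantization_lof {r : ℕ} (Φ : SymTensorField E M r) :
    (quantization hsmooth hbar (DirectSum.lof ℂ ℕ (fun j ↦ SymTensorField E M j) r Φ)).1 =
      quantizedHom hsmooth hbar r Φ := by
  rw [quantization, DirectSum.toModule_lof]
  rfl

theorem quantization_lof_apply {r : ℕ} (Φ : SymTensorField E M r) (f : SmoothFun E M) :
    ((quantization hsmooth hbar (DirectSum.lof ℂ ℕ (fun j ↦ SymTensorField E M j) r Φ)).1 f :
      M → ℂ) = quantized nabla hbar Φ f := by
  rw [quantization_lof, quantizedHom_apply]

theorem quantization_eq_sum {n : ℕ} {Φ : SymTensors E M} (hΦ : ∀ j, n ≤ j → Φ j = 0) :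
    quantization hsmooth hbar Φ = ∑ j ∈ Finset.range n, quantization hsmooth hbar
      (DirectSum.lof ℂ ℕ (fun j ↦ SymTensorField E M j) j (Φ j)) := by
  rw [← map_sum, ← eq_sum_lof hΦ]

theorem isSymbol_sum_quantizedHom (Φ : SymTensors E M) (n : ℕ) :
    IsSymbol n (∑ j ∈ Finset.range (n + 1), quantizedHom hsmooth hbar j (Φ j))
      ((-Complex.I * hbar) ^ n • Φ n) := by
  induction n with
  | zero =>
    rw [Finset.sum_range_one]
    exact isSymbol_quantizedHom hsmooth hbar (Φ 0)
  | succ n ih =>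
    rw [Finset.sum_range_succ, ← zero_add (_ • Φ (n + 1))]
    exact ih.1.isSymbol_succ_zero.add (isSymbol_quantizedHom hsmooth hbar (Φ (n + 1)))

theorem isSymbol_quantization_sub_sum {r n : ℕ} (hr : r ≤ n) {Φ : SymTensors E M}
    (hΦ : ∀ j, n < j → Φ j = 0) :
    IsSymbol r ((quantization hsmooth hbar Φ).1 - ∑ j ∈ Finset.Ioc r n, (quantization hsmooth hbar
      (DirectSum.lof ℂ ℕ (fun j ↦ SymTensorField E M j) j (Φ j))).1)
      ((-Complex.I * hbar) ^ r • Φ r) := by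
  rw [quantization_eq_sum hsmooth hbar hΦ, AddSubmonoidClass.coe_finsetSum]
  simp only [quantization_lof]
  have hdiff := sum_range_sub_sum_Ioc (fun j ↦ quantizedHom hsmooth hbar j (Φ j)) hr
  exact hdiff ▸ isSymbol_sum_quantizedHom hsmooth hbar Φ r

theorem isSymbol_quantization {n : ℕ} {Φ : SymTensors E M} (hΦ : ∀ j, n < j → Φ j = 0) :
    IsSymbol n (quantization hsmooth hbar Φ).1 ((-Complex.I * hbar) ^ n • Φ n) := by
  have hsub := isSymbol_quantization_sub_sum hsmooth hbar le_rfl hΦ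
  rwa [Finset.Ioc_self, Finset.sum_empty,
    sub_zero (G := SmoothFun E M →ₗ[ℂ] SmoothFun E M)] at hsub

variable {hbar}

theorem eq_zero_of_isSymbol_quantization_zero (hhbar : hbar ≠ 0) {r : ℕ} {Φ : SymTensors E M}
    (h : ∀ j, r ≤ j → IsSymbol j (quantization hsmooth hbar Φ).1 0) : ∀ j, r ≤ j → Φ j = 0 := by
  obtain ⟨n, hn⟩ := exists_forall_ge_eq_zero Φ
  induction n with
  | zero => exact fun j _ ↦ hn j j.zero_le
  | succ n ih =>
    rcases lt_or_ge n r with hnr | hrn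
    · exact fun j hj ↦ hn j (hnr.trans_le hj)
    · refine ih fun j hj ↦ hj.eq_or_lt.elim (fun hnj ↦ ?_) (hn j)
      subst hnj
      have htop := (isSymbol_quantization hsmooth hbar hn).unique (h n hrn)
      exact (smul_eq_zero.1 htop).resolve_left (pow_hbar_ne_zero hhbar n)

theorem eq_zero_of_hasOrder_quantization (hhbar : hbar ≠ 0) {r : ℕ} {Φ : SymTensors E M}
    (h : HasOrder r (quantization hsmooth hbar Φ).1) : ∀ j, r < j → Φ j = 0 :=
  eq_zero_of_isSymbol_quantization_zero (r := r + 1) hsmooth hhbar fun _ hj ↦ by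
    obtain ⟨m, rfl⟩ := Nat.exists_eq_add_of_le' hj
    exact (h.mono (Nat.le_add_left r m)).isSymbol_succ_zero

theorem quantization_injective (hhbar : hbar ≠ 0) :
    Function.Injective (quantization (E := E) (M := M) hsmooth hbar) := by
  refine (injective_iff_map_eq_zero _).2 fun Φ hΦ ↦ DFinsupp.ext fun j ↦ ?_
  refine eq_zero_of_isSymbol_quantization_zero (r := 0) hsmooth hhbar (fun j _ ↦ ?_) j j.zero_le
  rw [hΦ]
  exact isSymbol_zero

theorem exists_quantization_eq (hhbar : hbar ≠ 0) {r : ℕ}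
    {P : SmoothFun E M →ₗ[ℂ] SmoothFun E M} (hP : IsSymbol r P 0) :
    ∃ Φ, (quantization hsmooth hbar Φ).1 = P := by
  induction r generalizing P with
  | zero => exact ⟨0, by rw [hP.eq_zero, map_zero]; rfl⟩
  | succ r ih =>
    let Φr := ((-Complex.I * hbar) ^ r)⁻¹ • symbol hP.hasOrder
    have hsub := (isSymbol_symbol hP.hasOrder).sub (isSymbol_quantizedHom hsmooth hbar Φr)
    rw [smul_inv_smul₀ (pow_hbar_ne_zero hhbar r), sub_self] at hsub
    obtain ⟨Φ, hΦ⟩ := ih hsub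
    refine ⟨Φ + DirectSum.lof ℂ ℕ (fun j ↦ SymTensorField E M j) r Φr, ?_⟩
    rw [map_add, Submodule.coe_add, hΦ, quantization_lof]
    exact sub_add_cancel P _

theorem quantization_bijective (hhbar : hbar ≠ 0) :
    Function.Bijective (quantization (E := E) (M := M) hsmooth hbar) :=
  ⟨quantization_injective hsmooth hhbar, fun ⟨_, _, hP⟩ ↦
    (exists_quantization_eq hsmooth hhbar hP.isSymbol_succ_zero).imp fun _ ↦ Subtype.ext⟩

end Quantization

end Quantization

end

open Quantization in
theorem mainTheorem2_general
    {E : Type*} [NormedAddCommGroup E] [NormedSpace ℝ E] [FiniteDimensional ℝ E]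
    {M : Type*} [TopologicalSpace M] [T2Space M] [ChartedSpace E M] [IsManifold 𝓘(ℝ, E) ∞ M]
    (nabla : CovariantDerivative 𝓘(ℝ, E) E (TangentSpace 𝓘(ℝ, E) : M → Type _))
    (hsmooth : CovariantDerivative.ContMDiffCovariantDerivative nabla ∞)
    (hbar : ℝ) (hhbar : hbar ≠ 0) :
    (∀ (r : ℕ) (P : DiffOp E M), HasOrder r P.1 →
      ∃! σ : SymTensorField E M r, IsSymbol r P.1 σ) ∧
    ∃ Q : SymTensors E M ≃ₗ[ℂ] DiffOp E M,
      (∀ (r : ℕ) (Φ : SymTensorField E M r) (f : SmoothFun E M),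
        ((Q (DirectSum.lof ℂ ℕ (fun j ↦ SymTensorField E M j) r Φ)).1 f : M → ℂ) =
          quantized nabla hbar Φ f) ∧
      ∀ (r : ℕ) (P : DiffOp E M), HasOrder r P.1 → ∀ Φ : SymTensors E M, Q Φ = P →
        (∀ j, r < j → Φ j = 0) ∧
        IsSymbol r P.1 ((-Complex.I * hbar) ^ r • Φ r) ∧
        (∀ k, 1 ≤ k → k ≤ r →
          IsSymbol (r - k)
            (P.1 - ∑ j ∈ Finset.Ioc (r - k) r,
              (Q (DirectSum.lof ℂ ℕ (fun j ↦ SymTensorField E M j) j (Φ j))).1)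
            ((-Complex.I * hbar) ^ (r - k) • Φ (r - k))) ∧
        P = ∑ j ∈ Finset.range (r + 1),
          Q (DirectSum.lof ℂ ℕ (fun j ↦ SymTensorField E M j) j (Φ j)) := by
  refine ⟨fun r P hP ↦ ⟨symbol hP, isSymbol_symbol hP, fun σ hσ ↦ hσ.unique (isSymbol_symbol hP)⟩,
    LinearEquiv.ofBijective (quantization hsmooth hbar) (quantization_bijective hsmooth hhbar),
    fun r Φ f ↦ quantization_lof_apply hsmooth hbar Φ f, ?_⟩
  rintro r _ hP Φ rfl
  have hΦ := eq_zero_of_hasOrder_quantization hsmooth hhbar hP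
  exact ⟨hΦ, isSymbol_quantization hsmooth hbar hΦ,
    fun k _ _ ↦ isSymbol_quantization_sub_sum hsmooth hbar (r.sub_le k) hΦ,
    quantization_eq_sum hsmooth hbar hΦ⟩

open Quantization in
theorem mainTheorem2
    {E : Type*} [NormedAddCommGroup E] [NormedSpace ℝ E] [FiniteDimensional ℝ E]
    {M : Type*} [TopologicalSpace M] [T2Space M] [ChartedSpace E M] [IsManifold 𝓘(ℝ, E) ∞ M]
    (nabla : CovariantDerivative 𝓘(ℝ, E) E (TangentSpace 𝓘(ℝ, E) : M → Type _))
    (hsmooth : CovariantDerivative.ContMDiffCovariantDerivative nabla ∞)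
    (htorsion : nabla.torsion = 0)
    (hbar : ℝ) (hhbar : hbar ≠ 0) :
    -- each differential operator of order `r` has exactly one symbol of order `r`
    (∀ (r : ℕ) (P : DiffOp E M), HasOrder r P.1 →
      ∃! σ : SymTensorField E M r, IsSymbol r P.1 σ) ∧
    -- the quantization rule is a (linear) bijection
    ∃ Q : SymTensors E M ≃ₗ[ℂ] DiffOp E M,
      (∀ (r : ℕ) (Φ : SymTensorField E M r) (f : SmoothFun E M),
        ((Q (DirectSum.lof ℂ ℕ (fun j ↦ SymTensorField E M j) r Φ)).1 f : M → ℂ) =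
          quantized nabla hbar Φ f) ∧
      -- recursive determination of the tensor that corresponds to an operator of order `r`
      ∀ (r : ℕ) (P : DiffOp E M), HasOrder r P.1 → ∀ Φ : SymTensors E M, Q Φ = P →
        (∀ j, r < j → Φ j = 0) ∧
        IsSymbol r P.1 ((-Complex.I * hbar) ^ r • Φ r) ∧
        (∀ k, 1 ≤ k → k ≤ r →
          IsSymbol (r - k)
            (P.1 - ∑ j ∈ Finset.Ioc (r - k) r,
              (Q (DirectSum.lof ℂ ℕ (fun j ↦ SymTensorField E M j) j (Φ j))).1)
            ((-Complex.I * hbar) ^ (r - k) • Φ (r - k))) ∧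
        P = ∑ j ∈ Finset.range (r + 1),
          Q (DirectSum.lof ℂ ℕ (fun j ↦ SymTensorField E M j) j (Φ j)) :=
  mainTheorem2_general nabla hsmooth hbar hhbar
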